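/- Let $3\le k\le n$. A stick of length $1$ is broken at $n-1$ independent points, each uniformly distributed on $[0,1]$, into $n$ pieces. A choice of $k$ of the pieces forms a $k$-gon if the chosen pieces are, in some order, the side lengths of a nondegenerate simple polygon with $k$ sides in the Euclidean plane. Let $\bar Q(k,n)$ be the probability that at least one choice of $k$ pieces out of the $n$ does not form a $k$-gon, and let $Q(k,n)$ be the probability that every choice of $k$ pieces forms a $k$-gon. Let $Y_1\le\dots\le Y_n$ be the order statistics of a random sample of size $n$ from the exponential distribution with mean $1$. Put $$c_{rj}=(j+2)(k-1-r)+n-k+2,\qquad \lambda_{rj}=r+1+\frac{n-k+2}{j}.$$ Then $$\bar Q(k,n)=P\bigl(Y_n>Y_1+\dots+Y_{k-1}\bigr)=\frac{n!}{(n-k+2)!}\sum_{j=0}^{n-k}(-1)^j\binom{n-k+1}{j+1}\Bigl(\prod_{r=1}^{k-2}c_{rj}\Bigr)^{-1}.$$ Moreover, this agrees with Verreault's formula: $\bar Q(k,n)=1-Q(k,n)$, where $$Q(k,n)=\frac{n!}{(n-k+2)!\,(n-k+2)}\sum_{j=1}^{n-k+2}\frac{(-1)^{j+1}}{j^{k-3}}\binom{n-k+2}{j}\Bigl(\prod_{r=0}^{k-3}\lambda_{rj}\Bigr)^{-1},$$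 and for $k=n$ the value is $\bar Q(n,n)=n/2^{n-1}$. -/

import Mathlib

open MeasureTheory ProbabilityTheory

noncomputable section

namespace BrokenStick

/-- The values of a finite real sequence rearranged in nondecreasing order
(its order statistics); index `0` carries the smallest value. -/
def orderStat {m : ℕ} (x : Fin m → ℝ) : Fin m → ℝ :=
  x ∘ Tuple.sort x

/-- The lengths of the `m + 1` pieces of the stick `[0, 1]` broken at the points
`u 0, …, u (m - 1)`, listed from left to right: the differences of consecutive terms of
`0, u₍₁₎, …, u₍ₘ₎, 1`. -/
def pieces {m : ℕ} (u : Fin m → ℝ) : Fin (m + 1) → ℝ :=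
  fun i => (Fin.snoc (orderStat u) 1 : Fin (m + 1) → ℝ) i
    - (Fin.cons 0 (orderStat u) : Fin (m + 1) → ℝ) i

/-- A nondegenerate simple polygon in the Euclidean plane: consecutive edges are never collinear,
and edges that are not neighbours do not meet. -/
def IsSimplePolygon {k : ℕ} (p : Polygon (EuclideanSpace ℝ (Fin 2)) k) : Prop :=
  (∀ i : Fin k,
    AffineIndependent ℝ ![p i, p (finRotate k i), p (finRotate k (finRotate k i))]) ∧
  ∀ i j : Fin k, i ≠ j → finRotate k i ≠ j → finRotate k j ≠ i →
    Disjoint (p.edgeSet ℝ i) (p.edgeSet ℝ j)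

/-- The pieces with labels in `s`, of lengths `ℓ`, form a `k`-gon: they are, in some order, the
`k` sides of a simple polygon in the plane. -/
def FormsPolygon {ι : Type*} (k : ℕ) (ℓ : ι → ℝ) (s : Finset ι) : Prop :=
  ∃ (p : Polygon (EuclideanSpace ℝ (Fin 2)) k) (e : Fin k ≃ s),
    IsSimplePolygon p ∧ ∀ i : Fin k, dist (p i) (p (finRotate k i)) = ℓ (e i)

/-- `c_{rj} = (j + 2)(k - 1 - r) + n - k + 2`. -/
def coeffC (k n r j : ℕ) : ℝ :=
  ((j : ℝ) + 2) * ((k : ℝ) - 1 - r) + n - k + 2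

/-- `n! / (n - k + 2)! · ∑_{j=0}^{n-k} (-1)^j (n-k+1 choose j+1) (∏_{r=1}^{k-2} c_{rj})⁻¹`. -/
def failFormula (k n : ℕ) : ℝ :=
  (n.factorial : ℝ) / ((n - k + 2).factorial : ℝ) *
    ∑ j ∈ Finset.range (n - k + 1),
      (-1 : ℝ) ^ j * ((n - k + 1).choose (j + 1) : ℝ) *
        (∏ r ∈ Finset.Icc 1 (k - 2), coeffC k n r j)⁻¹

/-- `λ_{rj} = r + 1 + (n - k + 2) / j`. -/
def lam (k n r j : ℕ) : ℝ :=
  (r : ℝ) + 1 + ((n : ℝ) - k + 2) / j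

/-- Verreault's formula `n! / ((n - k + 2)! (n - k + 2)) ·
∑_{j=1}^{n-k+2} ((-1)^{j+1} / j^{k-3}) (n-k+2 choose j) (∏_{r=0}^{k-3} λ_{rj})⁻¹`. -/
def verreaultFormula (k n : ℕ) : ℝ :=
  (n.factorial : ℝ) / (((n - k + 2).factorial : ℝ) * ((n : ℝ) - k + 2)) *
    ∑ j ∈ Finset.Icc 1 (n - k + 2),
      ((-1 : ℝ) ^ (j + 1) / (j : ℝ) ^ (k - 3)) * ((n - k + 2).choose j : ℝ) *
        (∏ r ∈ Finset.range (k - 2), lam k n r j)⁻¹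

end BrokenStick

end

/-!
The proof compares the broken stick with an exponential sample and computes with the latter.

*Geometry.* Positive numbers are the side lengths of a simple polygon exactly if each is less than
the sum of the others (`formsPolygon_iff`). Necessity is the triangle inequality, strict because the
polygon turns at its vertices. For sufficiency a polygon is inscribed in a circle, its radius found
by the intermediate value theorem (`exists_halfAngles`), and disjointness of two sides is read off
from the position of chords of a circle (`disjoint_chords`). Hence some choice of `k` pieces fails
exactly if the longest piece is at least the sum of the `k - 1` shortest
(`exists_not_formsPolygon_iff`).

*Stick and exponential sample.* The last condition is invariant under scaling. Cutting the positive
orthant by the hyperplanes of constant coordinate sum shows that an exponential sample of size `n`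
gives a cone `A` the probability `(n - 1)!` times the volume of the slice of `A` at sum `1`
(`pi_expMeasure_cone`), and sorting the breaking points and passing to their gaps gives the same
value for the stick (`pi_uniform_pieces`). Both uses of sorting rest on `setLIntegral_orderStat`: an
integral of a function of the order statistics over the positive orthant is a factorial times an
integral over the gaps, because partial summation preserves volume.

*Exponential sample.* The gaps `Zᵢ` of the order statistics are independent and exponential with
rates `n, n - 1, …, 1` (`pi_expMeasure_orderStat`). The event becomes a comparison of a weighted sum
of the first `k - 2` gaps with the sum of the last `n - k + 1`. The latter is distributed as the
maximum of `n - k + 1` standard exponentials, so its tail is `1 - (1 - e⁻ᶜ) ^ (n - k + 1)`;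
expanding this binomially leaves a sum of products of Laplace transforms
(`pi_expMeasure_largestExceeds`), which is `failFormula`. The comparison with Verreault's formula is an
identity between finite sums (`failFormula_add_verreaultFormula`).
-/

open MeasureTheory ProbabilityTheory

namespace BrokenStick

open scoped ENNReal Pointwise

/-! ### Identities between the finite sums -/

/-- The product `∏ₛ ((s + 1)(i + 1) + d + 2)` over `0 ≤ s ≤ t`, to which the denominators of both
formulas reduce for `k = t + 3` and `n = t + 3 + d`. -/
def denom (t d i : ℕ) : ℝ :=
  ∏ s ∈ Finset.range (t + 1), (((s : ℝ) + 1) * ((i : ℝ) + 1) + d + 2)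

lemma denom_pos (t d i : ℕ) : 0 < denom t d i := Finset.prod_pos fun s _ => by positivity

lemma prod_coeffC (t d j : ℕ) :
    ∏ r ∈ Finset.Icc 1 (t + 1), coeffC (t + 3) (t + 3 + d) r j = denom t d (j + 1) := by
  rw [← Finset.Ico_add_one_right_eq_Icc, Finset.prod_Ico_eq_prod_range, denom,
    ← Finset.prod_range_reflect]
  refine Finset.prod_congr (by simp) fun i hi => ?_
  have hi' : i ≤ t := by simp at hi; omega
  simp only [coeffC, Nat.add_sub_cancel, Nat.cast_add,
    Nat.cast_sub hi', Nat.cast_one, Nat.cast_ofNat]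
  ring

lemma denom_zero (t d : ℕ) :
    ((d + 2).factorial : ℝ) * denom t d 0 = ((t + 3 + d).factorial : ℝ) := by
  have h := Nat.factorial_mul_ascFactorial (d + 2) (t + 1)
  rw [Nat.ascFactorial_eq_prod_range] at h
  rw [show t + 3 + d = d + 2 + (t + 1) by ring, ← h]
  push_cast [denom]
  congr 1
  refine Finset.prod_congr rfl fun s _ => by ring

lemma failFormula_eq_sum_denom (t d : ℕ) :
    failFormula (t + 3) (t + 3 + d) = ((t + 3 + d).factorial : ℝ) / ((d + 2).factorial : ℝ) *
      ∑ j ∈ Finset.range (d + 1),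
        (-1 : ℝ) ^ j * ((d + 1).choose (j + 1) : ℝ) / denom t d (j + 1) := by
  rw [failFormula, show t + 3 + d - (t + 3) = d by omega]
  simp only [show t + 3 - 2 = t + 1 by omega, prod_coeffC, div_eq_mul_inv]

lemma prod_lam (t d i : ℕ) :
    ∏ r ∈ Finset.range (t + 1), lam (t + 3) (t + 3 + d) r (i + 1)
      = denom t d i / ((i : ℝ) + 1) ^ (t + 1) := by
  have : ((i : ℝ) + 1) ^ (t + 1) = ∏ _r ∈ Finset.range (t + 1), ((i : ℝ) + 1) := by simp
  rw [denom, this, ← Finset.prod_div_distrib]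
  refine Finset.prod_congr rfl fun r _ => ?_
  have : (i : ℝ) + 1 ≠ 0 := by positivity
  simp only [lam]
  push_cast
  field_simp
  ring

lemma verreaultFormula_eq_sum_denom (t d : ℕ) :
    verreaultFormula (t + 3) (t + 3 + d) = ((t + 3 + d).factorial : ℝ) / ((d + 2).factorial : ℝ) *
      ∑ i ∈ Finset.range (d + 2), (-1 : ℝ) ^ i * ((d + 1).choose i : ℝ) / denom t d i := by
  rw [verreaultFormula, show t + 3 + d - (t + 3) = d by omega,
    ← Finset.Ico_add_one_right_eq_Icc, Finset.sum_Ico_eq_sum_range, Finset.mul_sum, Finset.mul_sum]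
  refine Finset.sum_congr (by simp) fun i _ => ?_
  have hch : ((d : ℝ) + 2) * ((d + 1).choose i : ℝ)
      = ((d + 2).choose (i + 1) : ℝ) * ((i : ℝ) + 1) := by
    exact_mod_cast Nat.add_one_mul_choose_eq (d + 1) i
  have hi : (i : ℝ) + 1 ≠ 0 := by positivity
  have hd : (d : ℝ) + 2 ≠ 0 := by positivity
  have hden := (denom_pos t d i).ne'
  have hf : ((d + 2).factorial : ℝ) ≠ 0 := by positivity
  rw [show t + 3 - 2 = t + 1 by omega, show t + 3 - 3 = t by omega, add_comm 1 i, prod_lam,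
    show ((t + 3 + d : ℕ) : ℝ) - ((t + 3 : ℕ) : ℝ) + 2 = (d : ℝ) + 2 by push_cast; ring]
  push_cast
  rw [show (-1 : ℝ) ^ (i + 1 + 1) = (-1) ^ i by ring]
  field_simp
  linear_combination (i + 1 : ℝ) ^ t * (-hch)

/-- Shifting the index by one, the two alternating sums cancel except for the `i = 0` term of
Verreault's, which is `(n - k + 2)! / n!`. -/
lemma failFormula_add_verreaultFormula {k n : ℕ} (hk : 3 ≤ k) (hkn : k ≤ n) :
    failFormula k n + verreaultFormula k n = 1 := by
  obtain ⟨t, rfl⟩ := Nat.exists_eq_add_of_le' hk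
  obtain ⟨d, rfl⟩ := Nat.exists_eq_add_of_le hkn
  rw [failFormula_eq_sum_denom, verreaultFormula_eq_sum_denom, ← mul_add,
    Finset.sum_range_succ' _ (d + 1), ← add_assoc, ← Finset.sum_add_distrib,
    Finset.sum_eq_zero, zero_add, ← denom_zero]
  · have := (denom_pos t d 0).ne'
    have hf : ((d + 2).factorial : ℝ) ≠ 0 := by positivity
    simp
    field_simp
  · intro j _
    ring

lemma failFormula_self {n : ℕ} (hn : 3 ≤ n) : failFormula n n = (n : ℝ) / 2 ^ (n - 1) := by
  obtain ⟨t, rfl⟩ := Nat.exists_eq_add_of_le' hn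
  have h := failFormula_eq_sum_denom t 0
  have hden : denom t 0 1 = 2 ^ (t + 1) * ((t + 2).factorial : ℝ) := by
    rw [denom, ← Finset.prod_range_add_one_eq_factorial, Finset.prod_range_succ' _ (t + 1)]
    push_cast
    rw [← Finset.card_range (t + 1), ← Finset.prod_const, Finset.card_range, mul_one,
      ← Finset.prod_mul_distrib]
    exact Finset.prod_congr rfl fun s _ => by ring
  have hf : ((t + 2).factorial : ℝ) ≠ 0 := by positivity
  have hfac : ((t + 3).factorial : ℝ) = (t + 3) * ((t + 2).factorial : ℝ) := by
    rw [Nat.factorial_succ]; push_cast; ring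
  simp only [add_zero, zero_add, Finset.sum_range_one, pow_zero, Nat.choose_self, Nat.cast_one,
    mul_one, Nat.factorial_two] at h
  rw [h, hden, hfac, show t + 3 - 1 = t + 2 by omega]
  push_cast
  field_simp
  ring

/-- The form in which the sum arises from the exponential sample. -/
lemma failFormula_eq_sum_prod (t d : ℕ) :
    failFormula (t + 3) (t + 3 + d) = ∑ j ∈ Finset.range (d + 1),
      (-1 : ℝ) ^ j * ((d + 1).choose (j + 1) : ℝ) * ∏ i : Fin (t + 1),
        (((t + 3 + d : ℕ) : ℝ) - (i : ℕ)) /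
          ((((t + 3 + d : ℕ) : ℝ) - (i : ℕ)) + ((j : ℝ) + 1) * ((t : ℝ) + 1 - (i : ℕ))) := by
  have hnum : ∏ i ∈ Finset.range (t + 1), (((t + 3 + d : ℕ) : ℝ) - (i : ℕ))
      = ((t + 3 + d).factorial : ℝ) / ((d + 2).factorial : ℝ) := by
    have hf : ((d + 2).factorial : ℝ) ≠ 0 := by positivity
    rw [eq_div_iff hf, ← denom_zero, mul_comm, denom, ← Finset.prod_range_reflect]
    congr 1
    refine Finset.prod_congr rfl fun i hi => ?_
    have hi' : i ≤ t := by simp at hi; omega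
    rw [show t + 1 - 1 - i = t - i by omega, Nat.cast_sub hi']
    push_cast
    ring
  rw [failFormula_eq_sum_denom, Finset.mul_sum]
  refine Finset.sum_congr rfl fun j _ => ?_
  rw [Fin.prod_univ_eq_prod_range (fun i : ℕ => (((t + 3 + d : ℕ) : ℝ) - (i : ℕ)) /
      ((((t + 3 + d : ℕ) : ℝ) - (i : ℕ)) + ((j : ℝ) + 1) * ((t : ℝ) + 1 - (i : ℕ)))),
    Finset.prod_div_distrib, hnum, denom, ← Finset.prod_range_reflect]
  have : ∏ i ∈ Finset.range (t + 1),
        (((t + 1 - 1 - i : ℕ) + 1 : ℝ) * (((j + 1 : ℕ) : ℝ) + 1) + d + 2)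
      = ∏ i ∈ Finset.range (t + 1),
        ((((t + 3 + d : ℕ) : ℝ) - (i : ℕ)) + ((j : ℝ) + 1) * ((t : ℝ) + 1 - (i : ℕ))) := by
    refine Finset.prod_congr rfl fun i hi => ?_
    have hi' : i ≤ t := by simp at hi; omega
    rw [show t + 1 - 1 - i = t - i by omega, Nat.cast_sub hi']
    push_cast
    ring
  rw [this]
  ring

/-! ### Side lengths of simple polygons -/

/-- The point at polar angle `2 * θ` on the circle of radius `R` about the origin. Doubling the
angle makes the chord from `θ` to `θ + φ` have length `2 * R * sin φ`. -/
noncomputable def circlePoint (R θ : ℝ) : EuclideanSpace ℝ (Fin 2) :=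
  !₂[R * Real.cos (2 * θ), R * Real.sin (2 * θ)]

lemma circlePoint_add_pi (R θ : ℝ) : circlePoint R (θ + Real.pi) = circlePoint R θ := by
  simp [circlePoint, mul_add]

lemma dist_circlePoint_zero {R : ℝ} (hR : 0 ≤ R) (θ : ℝ) : dist (circlePoint R θ) 0 = R := by
  rw [dist_zero_right, EuclideanSpace.norm_eq, ← Real.sqrt_sq hR]
  congr 1
  simp only [circlePoint, Real.norm_eq_abs, sq_abs, Fin.sum_univ_two, Real.sqrt_sq hR]
  simp
  linear_combination R ^ 2 * Real.sin_sq_add_cos_sq (2 * θ)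

lemma dist_circlePoint {R : ℝ} (hR : 0 ≤ R) (α β : ℝ) :
    dist (circlePoint R α) (circlePoint R β) = 2 * R * |Real.sin (β - α)| := by
  rw [← abs_of_nonneg (show 0 ≤ 2 * R by positivity), ← abs_mul, ← Real.sqrt_sq_eq_abs,
    EuclideanSpace.dist_eq]
  congr 1
  simp only [circlePoint, Real.dist_eq, sq_abs, Fin.sum_univ_two]
  simp only [Matrix.cons_val_zero, Matrix.cons_val_one]
  have h1 := Real.sin_sq_add_cos_sq (2 * α)
  have h2 := Real.sin_sq_add_cos_sq (2 * β)
  have h3 : Real.cos (2 * (β - α)) = Real.cos (2 * β) * Real.cos (2 * α)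
      + Real.sin (2 * β) * Real.sin (2 * α) := by rw [mul_sub, Real.cos_sub]
  have h4 := Real.cos_two_mul (β - α)
  have h5 := Real.sin_sq_add_cos_sq (β - α)
  linear_combination R ^ 2 * h1 + R ^ 2 * h2 + 2 * R ^ 2 * h3 - 2 * R ^ 2 * h4
    - 4 * R ^ 2 * h5

/-- Two chords of a circle are disjoint if both ends of the second lie on the open arc that
completes the first. The line through the first chord separates them. -/
lemma disjoint_chords {R α β γ δ : ℝ} (hR : 0 < R) (hβγ : β < γ) (hγ : γ < α + Real.pi)
    (hαβ : α < β) (hβδ : β < δ) (hδ : δ < α + Real.pi) :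
    Disjoint (affineSegment ℝ (circlePoint R α) (circlePoint R β))
      (affineSegment ℝ (circlePoint R γ) (circlePoint R δ)) := by
  -- The linear functional that is constant on the first chord.
  have key : ∀ θ, Real.cos (α + β) * circlePoint R θ 0 + Real.sin (α + β) * circlePoint R θ 1
      = R * Real.cos (β - α) - 2 * R * (Real.sin (θ - α) * Real.sin (θ - β)) := by
    intro θ
    have h1 := Real.cos_sub (2 * θ) (α + β)
    have h2 := Real.cos_sub_cos (2 * θ - (α + β)) (β - α)
    rw [show (2 * θ - (α + β) + (β - α)) / 2 = θ - α by ring,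
      show (2 * θ - (α + β) - (β - α)) / 2 = θ - β by ring] at h2
    simp only [circlePoint, PiLp.toLp_apply, Matrix.cons_val_zero, Matrix.cons_val_one]
    linear_combination R * h2 - R * h1
  have hpos : ∀ θ, β < θ → θ < α + Real.pi →
      0 < 2 * R * (Real.sin (θ - α) * Real.sin (θ - β)) := fun θ h h' =>
    mul_pos (by positivity) (mul_pos
      (Real.sin_pos_of_pos_of_lt_pi (by linarith) (by linarith))
      (Real.sin_pos_of_pos_of_lt_pi (by linarith) (by linarith)))
  rw [Set.disjoint_left]
  rintro _ ⟨s, hs, rfl⟩ ⟨t, ht, hst⟩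
  have h0 := congrArg (fun x : EuclideanSpace ℝ (Fin 2) => x 0) hst
  have h1 := congrArg (fun x : EuclideanSpace ℝ (Fin 2) => x 1) hst
  simp only [AffineMap.lineMap_apply, vsub_eq_sub, vadd_eq_add, PiLp.add_apply, PiLp.smul_apply,
    PiLp.sub_apply, smul_eq_mul] at h0 h1
  have kα := key α
  have kβ := key β
  have kγ := key γ
  have kδ := key δ
  simp only [sub_self, Real.sin_zero, mul_zero, zero_mul, sub_zero] at kα kβ
  have pγ := hpos γ hβγ hγ
  have pδ := hpos δ hβδ hδ
  set X := 2 * R * (Real.sin (γ - α) * Real.sin (γ - β))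
  set Y := 2 * R * (Real.sin (δ - α) * Real.sin (δ - β))
  have hXY : (1 - t) * X + t * Y = 0 := by
    linear_combination (1 - t) * kγ + t * kδ - (1 - s) * kα - s * kβ
      - Real.cos (α + β) * h0 - Real.sin (α + β) * h1
  rcases ht.1.eq_or_lt with rfl | ht0
  · simp at hXY
    exact pγ.ne' hXY
  · nlinarith [mul_pos ht0 pδ, mul_nonneg (sub_nonneg.2 ht.2) pγ.le]

/-- Positive half-angles adding up to `π` give an inscribed polygon, which is simple. -/
lemma exists_isSimplePolygon {k : ℕ} (hk : 3 ≤ k) {R : ℝ} (hR : 0 < R) (φ : Fin k → ℝ)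
    (hφ : ∀ i, 0 < φ i) (hsum : ∑ i, φ i = Real.pi) :
    ∃ p : Polygon (EuclideanSpace ℝ (Fin 2)) k, IsSimplePolygon p ∧
      ∀ i, dist (p i) (p (finRotate k i)) = 2 * R * Real.sin (φ i) := by
  obtain ⟨m, rfl⟩ : ∃ m, k = m + 1 := ⟨k - 1, by omega⟩
  -- Beyond the last index `f` only has to be positive, so that `Φ` increases on all of `ℕ`.
  set f : ℕ → ℝ := fun i => if h : i < m + 1 then φ ⟨i, h⟩ else 1 with hf
  set Φ : ℕ → ℝ := fun j => ∑ i ∈ Finset.range j, f i with hΦ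
  have hfpos : ∀ i, 0 < f i := by
    intro i
    simp only [hf]
    split_ifs
    exacts [hφ _, one_pos]
  have hfφ : ∀ i : Fin (m + 1), f i = φ i := fun i => dif_pos i.2
  have hmono : StrictMono Φ := strictMono_nat_of_lt_succ fun j => by
    simp only [hΦ, Finset.sum_range_succ]
    linarith [hfpos j]
  have h0 : Φ 0 = 0 := by simp [hΦ]
  have hlast : Φ (m + 1) = Real.pi := by
    simp only [hΦ]
    rw [Finset.sum_range, ← hsum]
    exact Finset.sum_congr rfl fun i _ => hfφ i
  have hnn : ∀ j, 0 ≤ Φ j := fun j => h0 ▸ hmono.monotone (Nat.zero_le j)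
  have hlt : ∀ j, j < m + 1 → Φ j < Real.pi := fun j hj => hlast ▸ hmono hj
  let p : Polygon (EuclideanSpace ℝ (Fin 2)) (m + 1) := ⟨fun i => circlePoint R (Φ i)⟩
  have hp : ∀ i, p i = circlePoint R (Φ i) := fun i => rfl
  -- The vertex after the last, at `Φ (m + 1) = π`, is the first one again.
  have hrot : ∀ i : Fin (m + 1), p (finRotate (m + 1) i) = circlePoint R (Φ (i + 1)) := by
    intro i
    rcases eq_or_ne i (Fin.last m) with rfl | hi
    · rw [finRotate_last, hp, Fin.val_last, hlast, Fin.val_zero, h0, ← circlePoint_add_pi, zero_add]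
    · rw [hp, coe_finRotate_of_ne_last hi]
  have hstep : ∀ i : Fin (m + 1), Φ (i + 1) - Φ i = φ i := fun i => by
    simp only [hΦ, Finset.sum_range_succ, hfφ]
    ring
  have hinj : ∀ i j : Fin (m + 1), i ≠ j → p i ≠ p j := by
    intro i j hij h
    have hd : |Real.sin (Φ j - Φ i)| = 0 := by
      have := dist_circlePoint hR.le (Φ i) (Φ j)
      rw [← hp, ← hp, h, dist_self] at this
      have := mul_eq_zero.1 this.symm
      exact this.resolve_left (by positivity)
    rw [abs_eq_zero] at hd
    have hi := hlt i i.2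
    have hj := hlt j j.2
    rcases lt_or_gt_of_ne hij with hij | hij
    · have := hmono (Fin.lt_def.1 hij)
      exact (Real.sin_pos_of_pos_of_lt_pi (by linarith) (by linarith [hnn i])).ne' hd
    · have := hmono (Fin.lt_def.1 hij)
      exact (Real.sin_neg_of_neg_of_neg_pi_lt (by linarith) (by linarith [hnn j])).ne hd
  have hdisj : ∀ i j : Fin (m + 1), i < j → finRotate (m + 1) i ≠ j → finRotate (m + 1) j ≠ i →
      Disjoint (p.edgeSet ℝ i) (p.edgeSet ℝ j) := by
    intro i j hij h1 h2
    have hil : i ≠ Fin.last m := (hij.trans_le (Fin.le_last j)).ne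
    have hij' : (i : ℕ) + 1 < j := by
      have : (i : ℕ) + 1 ≠ j := fun h => h1 (Fin.ext (by rw [coe_finRotate_of_ne_last hil, h]))
      have := Fin.lt_def.1 hij
      omega
    have hδ : Φ (j + 1) < Φ i + Real.pi := by
      rcases eq_or_ne j (Fin.last m) with rfl | hj
      · rw [Fin.val_last, hlast]
        have : (0 : ℕ) < i := Nat.pos_of_ne_zero fun h => h2 (by
          rw [finRotate_last]; exact Fin.ext h.symm)
        have := hmono this
        linarith
      · have : (j : ℕ) < m := Fin.lt_last_iff_ne_last.2 hj
        linarith [hlt (j + 1) (by omega), hnn i]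
    rw [Polygon.edgeSet, Polygon.edgeSet, hrot, hrot, hp, hp]
    exact disjoint_chords hR (hmono hij') (by linarith [hlt j j.2, hnn i]) (hmono (by omega))
      (hmono (by omega)) hδ
  refine ⟨p, ⟨fun i => ?_, fun i j hij h1 h2 => ?_⟩, fun i => ?_⟩
  · have hne : ∀ c : Fin (m + 1), c ≠ 0 → i ≠ i + c := fun c hc h => hc (by simpa using h.symm)
    have h1 : (1 : Fin (m + 1)) ≠ 0 := fun h => by
      have := congrArg Fin.val h
      rw [Fin.val_one', Nat.mod_eq_of_lt (by omega)] at this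
      simp at this
    have h2 : (1 : Fin (m + 1)) + 1 ≠ 0 := fun h => by
      have := congrArg Fin.val h
      rw [Fin.val_add, Fin.val_one', Nat.mod_eq_of_lt (by omega : 1 < m + 1),
        Nat.mod_eq_of_lt (by omega)] at this
      simp at this
    have hcos : EuclideanGeometry.Cospherical (Metric.sphere (0 : EuclideanSpace ℝ (Fin 2)) R) :=
      ⟨0, R, fun _ h => h⟩
    have hmem : ∀ i, p i ∈ Metric.sphere (0 : EuclideanSpace ℝ (Fin 2)) R := fun i =>
      dist_circlePoint_zero hR.le _
    refine hcos.affineIndependent_of_mem_of_ne (hmem _) (hmem _) (hmem _) (hinj _ _ ?_)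
      (hinj _ _ ?_) (hinj _ _ ?_)
    · rw [finRotate_apply]; exact hne 1 h1
    · rw [finRotate_apply, finRotate_apply, add_assoc]; exact hne _ h2
    · rw [finRotate_apply, finRotate_apply]
      intro h
      exact h1 (by simpa using h.symm)
  · rcases lt_or_gt_of_ne hij with hij | hij
    · exact hdisj i j hij h1 h2
    · exact (hdisj j i hij h2 h1).symm
  · rw [hrot, hp, dist_circlePoint hR.le, hstep, abs_of_nonneg]
    refine (Real.sin_pos_of_pos_of_lt_pi (hφ i) ?_).le
    have h1 := hlt i i.2
    rcases (Nat.eq_zero_or_pos (i : ℕ)) with hi | hi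
    · rw [← hstep, hi, h0, sub_zero, zero_add]
      exact hlt 1 (by omega)
    · have := hmono hi
      have h2 : Φ (i + 1) ≤ Real.pi := hlast ▸ hmono.monotone (by omega)
      linarith [hstep i]

/-- The circumradius and the half-angles of the inscribed polygon with side lengths `a`. The
unknown `ρ = 1 / (2 R)` solves `sin (∑ arcsin (ρ aᵢ)) = ρ a_M`, where the sum omits a longest side
`a_M`. Capping the sum at `π` keeps the intermediate value argument free of a case distinction on
whether the centre lies inside the polygon. -/
lemma exists_halfAngles {ι : Type*} [Fintype ι] [Nonempty ι] (a : ι → ℝ) (ha : ∀ i, 0 < a i)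
    (hlt : ∀ i, 2 * a i < ∑ j, a j) :
    ∃ (R : ℝ) (φ : ι → ℝ), 0 < R ∧ (∀ i, 0 < φ i) ∧ ∑ i, φ i = Real.pi ∧
      ∀ i, 2 * R * Real.sin (φ i) = a i := by
  classical
  obtain ⟨M, hM⟩ := Finite.exists_max a
  set A := a M with hA
  have hApos : 0 < A := ha M
  set s := Finset.univ.erase M with hs
  have hsum : ∀ f : ι → ℝ, ∑ i, f i = ∑ i ∈ s, f i + f M := fun f =>
    (Finset.sum_erase_add _ _ (Finset.mem_univ M)).symm
  have hB : A < ∑ i ∈ s, a i := by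
    have := hlt M
    rw [hsum] at this
    linarith
  set S : ℝ → ℝ := fun ρ => ∑ i ∈ s, Real.arcsin (ρ * a i) with hS
  have hScont : Continuous S := by fun_prop
  set h : ℝ → ℝ := fun ρ => Real.sin (min (S ρ) Real.pi) - ρ * A with hh
  have hcont : Continuous h := by fun_prop
  -- The positive derivative at `0` makes `h` positive just to the right of `0`; at `1 / a_M` it is
  -- nonpositive.
  have hderiv : HasDerivAt (fun ρ => Real.sin (S ρ) - ρ * A) (∑ i ∈ s, a i - A) 0 := by
    have h1 : HasDerivAt S (∑ i ∈ s, a i) 0 := by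
      refine HasDerivAt.fun_sum fun i _ => ?_
      have h2 : HasDerivAt (fun ρ : ℝ => ρ * a i) (a i) 0 := by
        simpa using (hasDerivAt_id (0 : ℝ)).mul_const (a i)
      have h3 : HasDerivAt Real.arcsin 1 ((fun ρ : ℝ => ρ * a i) 0) := by
        simpa using Real.hasDerivAt_arcsin (x := 0) (by norm_num) (by norm_num)
      have h4 := h3.comp (0 : ℝ) h2
      rw [one_mul] at h4
      exact h4
    have h0 : S 0 = 0 := by simp [hS]
    have h4 : HasDerivAt (fun ρ : ℝ => ρ * A) A 0 := by
      simpa using (hasDerivAt_id (0 : ℝ)).mul_const A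
    have := h1.sin
    rw [h0, Real.cos_zero, one_mul] at this
    exact this.sub h4
  obtain ⟨ρ₀, hρ₀, hρ₀A, hpos⟩ : ∃ ρ₀, 0 < ρ₀ ∧ ρ₀ ≤ 1 / A ∧ 0 < h ρ₀ := by
    have hslope := (hasDerivAt_iff_tendsto_slope.1 hderiv).mono_left
      (nhdsWithin_mono (0 : ℝ) (show Set.Ioi (0 : ℝ) ⊆ {0}ᶜ from fun x hx => ne_of_gt hx))
    have e1 := hslope.eventually_const_lt (sub_pos.2 hB)
    have e2 : ∀ᶠ ρ in nhdsWithin (0 : ℝ) (Set.Ioi 0), S ρ < Real.pi :=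
      (hScont.tendsto' 0 0 (by simp [hS])).eventually_lt_const Real.pi_pos |>.filter_mono
        nhdsWithin_le_nhds
    have e3 : ∀ᶠ ρ in nhdsWithin (0 : ℝ) (Set.Ioi 0), ρ ∈ Set.Ioo 0 (1 / A) :=
      Ioo_mem_nhdsGT (by positivity)
    obtain ⟨ρ, h1, h2, h3⟩ := (e1.and (e2.and e3)).exists
    refine ⟨ρ, h3.1, h3.2.le, ?_⟩
    simp only [hh, min_eq_left h2.le]
    simp only [slope_def_field, hS, zero_mul, Real.arcsin_zero, Finset.sum_const_zero,
      Real.sin_zero, sub_zero] at h1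
    exact (div_pos_iff_of_pos_right h3.1).1 h1
  have hend : h (1 / A) ≤ 0 := by
    simp only [hh, one_div, inv_mul_cancel₀ hApos.ne']
    linarith [Real.sin_le_one (min (S A⁻¹) Real.pi)]
  obtain ⟨ρ, ⟨hρ1, hρ2⟩, hρ⟩ := intermediate_value_Icc' hρ₀A hcont.continuousOn ⟨hend, hpos.le⟩
  have hρpos : 0 < ρ := hρ₀.trans_le hρ1
  -- The root lies before the cap, because `sin π = 0`.
  have hSpi : S ρ < Real.pi := by
    by_contra hcon
    simp only [hh, min_eq_right (not_lt.1 hcon), Real.sin_pi, zero_sub, neg_eq_zero] at hρ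
    exact (mul_pos hρpos hApos).ne' hρ
  simp only [hh, min_eq_left hSpi.le, sub_eq_zero] at hρ
  have hle : ∀ i, ρ * a i ≤ 1 := fun i =>
    calc ρ * a i ≤ 1 / A * A := mul_le_mul hρ2 (hM i) (ha i).le (by positivity)
      _ = 1 := by field_simp
  refine ⟨1 / (2 * ρ), fun i => if i = M then Real.pi - S ρ else Real.arcsin (ρ * a i),
    by positivity, fun i => ?_, ?_, fun i => ?_⟩
  · dsimp only
    split_ifs
    · linarith
    · exact Real.arcsin_pos.2 (mul_pos hρpos (ha i))
  · rw [hsum, if_pos rfl, Finset.sum_congr rfl fun i hi => if_neg (Finset.ne_of_mem_erase hi)]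
    simp only [hS, ← hs]
    ring
  · dsimp only
    split_ifs with hi
    · rw [Real.sin_pi_sub, hρ, hi, ← hA]
      field_simp
    · rw [Real.sin_arcsin (by linarith [mul_pos hρpos (ha i)]) (hle i)]
      field_simp

/-- Going the other way round, the path from one end of an edge to the other is strictly longer:
it has a vertex at which it turns. -/
lemma IsSimplePolygon.two_mul_dist_lt {k : ℕ} (hk : 3 ≤ k)
    {p : Polygon (EuclideanSpace ℝ (Fin 2)) k} (hp : IsSimplePolygon p) (i : Fin k) :
    2 * dist (p i) (p (finRotate k i)) < ∑ j, dist (p j) (p (finRotate k j)) := by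
  obtain ⟨m, rfl⟩ : ∃ m, k = m + 1 := ⟨k - 1, by omega⟩
  set c : ℕ → Fin (m + 1) := Fin.ofNat (m + 1) with hc
  have hc0 : c 0 = 0 := rfl
  have hcs : ∀ j, c (j + 1) = c j + 1 := fun j => by
    ext
    simp [hc, Fin.val_add]
  have hcval : ∀ j : Fin (m + 1), c j = j := fun j => by
    ext
    simp [hc]
  have hcm : c m + 1 = 0 := by
    rw [← hcs]
    ext
    simp [hc]
  set q : ℕ → EuclideanSpace ℝ (Fin 2) := fun j => p (i + 1 + c j) with hq
  have hqs : ∀ j, q (j + 1) = p (finRotate (m + 1) (i + 1 + c j)) := fun j => by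
    rw [finRotate_apply, add_assoc, ← hcs]
  have hqm : q m = p i := by
    simp only [hq]
    rw [add_assoc, add_comm 1, hcm, add_zero]
  have hq0 : q 0 = p (finRotate (m + 1) i) := by
    rw [finRotate_apply]
    simp only [hq, hc0, add_zero]
  have hqm1 : q (m + 1) = p (finRotate (m + 1) i) := by
    simp only [hq]
    rw [hcs, hcm, add_zero, finRotate_apply]
  have hsum : ∑ j, dist (p j) (p (finRotate (m + 1) j))
      = ∑ j ∈ Finset.range (m + 1), dist (q j) (q (j + 1)) := by
    rw [Finset.sum_range, ← Equiv.sum_comp (Equiv.addLeft (i + 1))]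
    refine Finset.sum_congr rfl fun j _ => ?_
    rw [hqs]
    simp only [hq, hcval, Equiv.coe_addLeft]
  have hstrict : dist (q 0) (q 2) < dist (q 0) (q 1) + dist (q 1) (q 2) := by
    refine lt_of_le_of_ne (dist_triangle _ _ _) fun h => ?_
    have hw := (dist_add_dist_eq_iff.1 h.symm).collinear
    have hai := hp.1 (finRotate (m + 1) i)
    rw [affineIndependent_iff_not_collinear_set] at hai
    have hq1 : q 1 = p (finRotate (m + 1) (finRotate (m + 1) i)) := by
      rw [hqs, hc0, add_zero, finRotate_apply i]
    have hq2 : q 2 = p (finRotate (m + 1) (finRotate (m + 1) (finRotate (m + 1) i))) := by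
      rw [hqs, hcs, hc0, zero_add, finRotate_apply i, finRotate_apply (i + 1)]
    rw [hq0, hq1, hq2] at hw
    exact hai hw
  have hpath : dist (q 2) (q m) ≤ ∑ j ∈ Finset.Ico 2 m, dist (q j) (q (j + 1)) :=
    dist_le_Ico_sum_dist q (by omega)
  have hsplit : ∑ j ∈ Finset.range m, dist (q j) (q (j + 1))
      = dist (q 0) (q 1) + dist (q 1) (q 2) + ∑ j ∈ Finset.Ico 2 m, dist (q j) (q (j + 1)) := by
    rw [← Finset.sum_range_add_sum_Ico _ (show 2 ≤ m by omega), Finset.sum_range_succ,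
      Finset.sum_range_one]
  have htri := dist_triangle (q 0) (q 2) (q m)
  rw [hsum, Finset.sum_range_succ, hsplit, hqm1, hqm]
  rw [hqm, hq0, dist_comm] at htri
  rw [hqm] at hpath
  rw [hq0] at hstrict ⊢
  linarith

/-- Positive lengths are the sides of a simple polygon exactly if each is less than the sum of
the others. -/
lemma formsPolygon_iff {ι : Type*} {k : ℕ} (hk : 3 ≤ k) {ℓ : ι → ℝ} (hℓ : ∀ i, 0 < ℓ i)
    {s : Finset ι} (hs : s.card = k) :
    FormsPolygon k ℓ s ↔ ∀ i ∈ s, 2 * ℓ i < ∑ j ∈ s, ℓ j := by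
  constructor
  · rintro ⟨p, e, hp, hd⟩ i hi
    have h := hp.two_mul_dist_lt hk (e.symm ⟨i, hi⟩)
    simp only [hd, Equiv.apply_symm_apply] at h
    rwa [e.sum_comp (fun j : s => ℓ j), Finset.sum_coe_sort s ℓ] at h
  · intro h
    have e : Fin k ≃ s := (Fin.castOrderIso hs.symm).toEquiv.trans s.equivFin.symm
    have : Nonempty (Fin k) := ⟨⟨0, by omega⟩⟩
    obtain ⟨R, φ, hR, hφ, hsum, hsin⟩ := exists_halfAngles (fun i => ℓ (e i)) (fun i => hℓ _)
      (fun i => by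
        rw [e.sum_comp (fun j : s => ℓ j), Finset.sum_coe_sort s ℓ]
        exact h _ (e i).2)
    obtain ⟨p, hp, hd⟩ := exists_isSimplePolygon hk hR φ hφ hsum
    exact ⟨p, e, hp, fun i => (hd i).trans (hsin i)⟩

/-! ### Choices of pieces and order statistics -/

lemma monotone_orderStat {m : ℕ} (x : Fin m → ℝ) : Monotone (orderStat x) :=
  Tuple.monotone_sort x

lemma sum_first_le_sum {n r : ℕ} (hr : r ≤ n) {y : Fin n → ℝ} (hy : Monotone y)
    {t : Finset (Fin n)} (ht : t.card = r) :
    ∑ i : Fin r, y (Fin.castLE hr i) ≤ ∑ i ∈ t, y i := by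
  set f := t.orderEmbOfFin ht
  have hle : ∀ (j : ℕ) (hj : j < r), j ≤ f ⟨j, hj⟩ := by
    intro j
    induction j with
    | zero => exact fun _ => Nat.zero_le _
    | succ j ih =>
      intro hj
      have h1 : f ⟨j, by omega⟩ < f ⟨j + 1, hj⟩ := f.strictMono (by simp)
      have := ih (by omega)
      have := Fin.lt_def.1 h1
      omega
  rw [← Finset.sum_coe_sort t y, ← (t.orderIsoOfFin ht).toEquiv.sum_comp]
  exact Finset.sum_le_sum fun i _ => hy (hle i i.2)

lemma pred_le_of_le {k n : ℕ} (hkn : k ≤ n) : k - 1 ≤ n := by omega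

lemma pred_lt_of_three_le {k n : ℕ} (hk : 3 ≤ k) (hkn : k ≤ n) : n - 1 < n := by omega

/-- Some choice of `k` pieces fails exactly if the choice of the longest together with the `k - 1`
shortest does. -/
lemma exists_not_formsPolygon_iff {k n : ℕ} (hk : 3 ≤ k) (hkn : k ≤ n) {x : Fin n → ℝ}
    (hx : ∀ i, 0 < x i) :
    (∃ s : Finset (Fin n), s.card = k ∧ ¬ FormsPolygon k x s) ↔
      ∑ i : Fin (k - 1), orderStat x (Fin.castLE (pred_le_of_le hkn) i)
        ≤ orderStat x ⟨n - 1, pred_lt_of_three_le hk hkn⟩ := by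
  constructor
  · rintro ⟨s, hs, hf⟩
    rw [formsPolygon_iff hk hx hs] at hf
    push Not at hf
    obtain ⟨i, hi, hle⟩ := hf
    set t := (s.erase i).map (Tuple.sort x).symm.toEmbedding with ht
    have hcard : t.card = k - 1 := by rw [ht, Finset.card_map, Finset.card_erase_of_mem hi, hs]
    have hsum : ∑ j ∈ t, orderStat x j = ∑ j ∈ s.erase i, x j := by
      rw [ht, Finset.sum_map]
      simp [orderStat]
    calc _ ≤ ∑ j ∈ t, orderStat x j := sum_first_le_sum _ (monotone_orderStat x) hcard
      _ ≤ x i := by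
          rw [hsum]
          linarith [Finset.sum_erase_add s x hi]
      _ = orderStat x ((Tuple.sort x).symm i) := by simp [orderStat]
      _ ≤ _ := monotone_orderStat x (Fin.le_def.2 (by
          have := ((Tuple.sort x).symm i).2
          simp only
          omega))
  · intro h
    set a : Finset (Fin n) :=
      Finset.univ.map (Fin.castLEEmb (show k - 1 ≤ n by omega)) with ha
    set l : Fin n := ⟨n - 1, by omega⟩ with hl
    have hla : l ∉ a := by
      simp only [ha, hl, Finset.mem_map, Finset.mem_univ, true_and, not_exists]
      intro i hi
      have := congrArg Fin.val hi
      simp at this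
      omega
    have hcard : ((Finset.cons l a hla).map (Tuple.sort x).toEmbedding).card = k := by
      rw [Finset.card_map, Finset.card_cons, ha, Finset.card_map, Finset.card_univ,
        Fintype.card_fin]
      omega
    refine ⟨_, hcard, fun hf => ?_⟩
    · rw [formsPolygon_iff hk hx hcard] at hf
      have := hf (Tuple.sort x l) (by simp)
      rw [Finset.sum_map, Finset.sum_cons, ha, Finset.sum_map] at this
      simp only [orderStat, Function.comp_apply] at h
      simp only [Equiv.coe_toEmbedding, Fin.coe_castLEEmb] at this
      linarith

/-! ### Products of measures with densities -/

lemma lintegral_pi_prod {n : ℕ} (ν : Fin n → Measure ℝ) [∀ i, SigmaFinite (ν i)]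
    (f : Fin n → ℝ → ℝ≥0∞) (hf : ∀ i, Measurable (f i)) :
    ∫⁻ x, ∏ i, f i (x i) ∂Measure.pi ν = ∏ i, ∫⁻ t, f i t ∂ν i := by
  induction n with
  | zero => simp
  | succ n ih =>
    have e := (measurePreserving_piFinSuccAbove (α := fun _ => ℝ) ν 0).symm
    rw [← e.lintegral_comp_emb (MeasurableEquiv.measurableEmbedding _), Fin.prod_univ_succ,
      ← ih (fun i => ν i.succ) (fun i => f i.succ) (fun i => hf _)]
    simp only [MeasurableEquiv.piFinSuccAbove_symm_apply, Fin.insertNthEquiv,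
      Fin.prod_univ_succ, Fin.insertNth_zero, Equiv.coe_fn_mk, Fin.cons_succ,
      Fin.zero_succAbove, Fin.cons_zero]
    exact lintegral_prod_mul (μ := ν 0) (ν := Measure.pi fun i => ν i.succ) (f := f 0)
      (g := fun x : Fin n → ℝ => ∏ i, f i.succ (x i))
      (hf 0).aemeasurable
      (Finset.measurable_prod _ fun i _ => (hf _).comp (measurable_pi_apply i)).aemeasurable

lemma pi_withDensity {n : ℕ} (ν : Fin n → Measure ℝ) [∀ i, SigmaFinite (ν i)]
    (f : Fin n → ℝ → ℝ≥0∞) (hf : ∀ i, Measurable (f i))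
    [∀ i, SigmaFinite ((ν i).withDensity (f i))] :
    Measure.pi (fun i => (ν i).withDensity (f i))
      = (Measure.pi ν).withDensity fun x => ∏ i, f i (x i) := by
  refine Measure.pi_eq fun s hs => ?_
  rw [withDensity_apply _ (MeasurableSet.univ_pi hs), Measure.restrict_pi_pi,
    lintegral_pi_prod _ _ hf]
  exact Finset.prod_congr rfl fun i _ => (withDensity_apply _ (hs i)).symm

/-- The open positive orthant. -/
def posOrthant (n : ℕ) : Set (Fin n → ℝ) := Set.univ.pi fun _ => Set.Ioi 0

lemma mem_posOrthant {n : ℕ} {x : Fin n → ℝ} : x ∈ posOrthant n ↔ ∀ i, 0 < x i := by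
  simp [posOrthant]

lemma measurableSet_posOrthant (n : ℕ) : MeasurableSet (posOrthant n) :=
  MeasurableSet.univ_pi fun _ => measurableSet_Ioi

lemma expMeasure_eq (r : ℝ) : expMeasure r
    = (volume.restrict (Set.Ioi 0)).withDensity
        fun x => ENNReal.ofReal (r * Real.exp (-(r * x))) := by
  rw [restrict_Ioi_eq_restrict_Ici, ← withDensity_indicator measurableSet_Ici, expMeasure,
    gammaMeasure]
  congr 1
  ext x
  change exponentialPDF r x = _
  rw [exponentialPDF_eq]
  by_cases hx : 0 ≤ x <;> simp [hx]

lemma pi_expMeasure {n : ℕ} {r : Fin n → ℝ} (hr : ∀ i, 0 < r i) :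
    Measure.pi (fun i => expMeasure (r i)) = (volume.restrict (posOrthant n)).withDensity
      fun x => ENNReal.ofReal ((∏ i, r i) * Real.exp (-∑ i, r i * x i)) := by
  have : ∀ i, SigmaFinite ((volume.restrict (Set.Ioi 0)).withDensity
      fun x => ENNReal.ofReal (r i * Real.exp (-(r i * x)))) := fun i => by
    rw [← expMeasure_eq]
    have := isProbabilityMeasure_expMeasure (hr i)
    infer_instance
  simp_rw [expMeasure_eq]
  rw [pi_withDensity (fun _ => volume.restrict (Set.Ioi 0))
    (fun i x => ENNReal.ofReal (r i * Real.exp (-(r i * x)))) (fun i => by fun_prop),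
    ← Measure.restrict_pi_pi, ← volume_pi, posOrthant]
  congr 1
  ext x
  rw [← ENNReal.ofReal_prod_of_nonneg fun i _ => by have := hr i; positivity,
    Finset.prod_mul_distrib, ← Finset.sum_neg_distrib, Real.exp_sum]

lemma pi_expMeasure_posOrthant {n : ℕ} {r : Fin n → ℝ} (hr : ∀ i, 0 < r i) :
    ∀ᵐ x ∂Measure.pi (fun i => expMeasure (r i)), x ∈ posOrthant n := by
  rw [pi_expMeasure hr]
  exact (withDensity_absolutelyContinuous _ _).ae_le
    (ae_restrict_mem (measurableSet_posOrthant n))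

/-! ### Order statistics and partial sums -/

lemma orderStat_comp {n : ℕ} (x : Fin n → ℝ) (σ : Equiv.Perm (Fin n)) :
    orderStat (x ∘ σ) = orderStat x :=
  Tuple.comp_perm_comp_sort_eq_comp_sort

lemma orderStat_of_monotone {n : ℕ} {x : Fin n → ℝ} (hx : Monotone x) : orderStat x = x := by
  rw [orderStat, Tuple.sort_eq_refl_iff_monotone.2 hx]
  rfl

lemma measurable_orderStat {n : ℕ} : Measurable (orderStat : (Fin n → ℝ) → Fin n → ℝ) := by
  let _ : MeasurableSpace (Equiv.Perm (Fin n)) := ⊤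
  have hsort : Measurable (Tuple.sort : (Fin n → ℝ) → Equiv.Perm (Fin n)) := by
    refine measurable_to_countable' fun σ => ?_
    have : Tuple.sort ⁻¹' {σ} = {x : Fin n → ℝ | ∀ i j, (i ≤ j → x (σ i) ≤ x (σ j)) ∧
        (i < j → x (σ i) = x (σ j) → σ i < σ j)} := by
      ext x
      rw [Set.mem_preimage, Set.mem_singleton_iff, eq_comm, Tuple.eq_sort_iff]
      simp only [Set.mem_ofPred_eq, Monotone, Function.comp_apply, forall_and]
    rw [this]
    have hle : ∀ i j, MeasurableSet {x : Fin n → ℝ | x (σ i) ≤ x (σ j)} := fun i j =>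
      measurableSet_le (measurable_pi_apply _) (measurable_pi_apply _)
    have heq : ∀ i j, MeasurableSet {x : Fin n → ℝ | x (σ i) = x (σ j)} := fun i j =>
      measurableSet_eq_fun (measurable_pi_apply _) (measurable_pi_apply _)
    simp only [Set.ofPred_forall]
    refine MeasurableSet.iInter fun i => MeasurableSet.iInter fun j => ?_
    exact ((MeasurableSet.const _).imp (hle i j)).inter
      ((MeasurableSet.const _).imp ((heq i j).imp (MeasurableSet.const _)))
  have hev : Measurable fun p : Equiv.Perm (Fin n) × (Fin n → ℝ) => p.2 ∘ p.1 :=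
    measurable_from_prod_countable_right fun σ =>
      measurable_pi_lambda _ fun i => measurable_pi_apply (σ i)
  exact hev.comp (hsort.prodMk measurable_id)

lemma ae_injective (n : ℕ) : ∀ᵐ x : Fin n → ℝ, Function.Injective x := by
  have : ∀ i j : Fin n, i ≠ j → ∀ᵐ x : Fin n → ℝ, x i ≠ x j := by
    intro i j hij
    let φ : (Fin n → ℝ) →ₗ[ℝ] ℝ := LinearMap.proj (R := ℝ) (φ := fun _ => ℝ) i -
      LinearMap.proj (R := ℝ) (φ := fun _ => ℝ) j
    have hφ : LinearMap.ker φ ≠ ⊤ := by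
      intro h
      have : φ (Pi.single i 1) = 0 := LinearMap.mem_ker.1 (h ▸ Submodule.mem_top)
      simp [φ, hij.symm] at this
    rw [ae_iff]
    convert Measure.addHaar_submodule volume _ hφ using 2
    ext x
    simp [φ, sub_eq_zero]
  have h : ∀ᵐ x : Fin n → ℝ, ∀ i j : Fin n, i ≠ j → x i ≠ x j := by
    simp only [ae_all_iff]
    exact this
  filter_upwards [h] with x hx i j hij
  by_contra hne
  exact hx i j hne hij

lemma measurableSet_strictMono (n : ℕ) : MeasurableSet {x : Fin n → ℝ | StrictMono x} := by
  simp only [StrictMono, Set.ofPred_forall]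
  exact MeasurableSet.iInter fun i => MeasurableSet.iInter fun j => MeasurableSet.iInter fun _ =>
    measurableSet_lt (measurable_pi_apply _) (measurable_pi_apply _)

/-- The chambers `x ∘ σ` strictly increasing fill the space up to a null set and are exchanged by
permutations of the coordinates. -/
lemma lintegral_eq_factorial_mul {n : ℕ} (F : (Fin n → ℝ) → ℝ≥0∞)
    (hF : ∀ (x : Fin n → ℝ) (σ : Equiv.Perm (Fin n)), F (x ∘ σ) = F x) :
    ∫⁻ x, F x = n.factorial * ∫⁻ x in {x | StrictMono x}, F x := by
  let S : Equiv.Perm (Fin n) → Set (Fin n → ℝ) := fun σ => {x | StrictMono (x ∘ σ)}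
  have hmeas : ∀ σ : Equiv.Perm (Fin n), Measurable fun x : Fin n → ℝ => x ∘ σ := fun σ =>
    measurable_pi_lambda _ fun i => measurable_pi_apply _
  have hSm : ∀ σ, MeasurableSet (S σ) := fun σ => hmeas σ (measurableSet_strictMono n)
  have hdisj : Pairwise (Function.onFun Disjoint S) := by
    intro σ τ hστ
    refine Set.disjoint_left.2 fun x hσ hτ => hστ ?_
    have hσ' : StrictMono (x ∘ σ) := hσ
    have hτ' : StrictMono (x ∘ τ) := hτ
    have h := Tuple.unique_monotone hσ'.monotone hτ'.monotone
    have hinj : Function.Injective x := by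
      have := hσ'.injective.comp σ.symm.injective
      simpa [Function.comp_assoc] using this
    exact Equiv.ext fun i => hinj (congrFun h i)
  have hunion : (⋃ σ, S σ) =ᵐ[volume] Set.univ := by
    rw [ae_eq_univ, ← compl_mem_ae_iff, compl_compl]
    filter_upwards [ae_injective n] with x hx
    exact Set.mem_iUnion.2 ⟨Tuple.sort x,
      (Tuple.monotone_sort x).strictMono_of_injective (hx.comp (Tuple.sort x).injective)⟩
  have hpiece : ∀ σ, ∫⁻ x in S σ, F x = ∫⁻ x in {x | StrictMono x}, F x := by
    intro σ
    have hmp := (volume_measurePreserving_piCongrLeft (fun _ : Fin n => ℝ) σ).symm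
    have hcoe : ∀ x : Fin n → ℝ,
        (MeasurableEquiv.piCongrLeft (fun _ : Fin n => ℝ) σ).symm x = x ∘ σ := fun x => rfl
    rw [← hmp.setLIntegral_comp_preimage_emb (MeasurableEquiv.measurableEmbedding _) F
      {x | StrictMono x}]
    simp only [hcoe, hF]
    rfl
  rw [← setLIntegral_univ, ← setLIntegral_congr hunion, lintegral_iUnion hSm hdisj, tsum_fintype]
  simp [hpiece, Fintype.card_perm]

/-- The partial sums `zᵢ ↦ z₀ + ⋯ + zᵢ`, turning gaps into an increasing sequence. -/
def partialSums {n : ℕ} (z : Fin n → ℝ) : Fin n → ℝ := fun i => ∑ j ∈ Finset.Iic i, z j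

lemma measurePreserving_partialSums (n : ℕ) :
    MeasurePreserving (partialSums : (Fin n → ℝ) → Fin n → ℝ) := by
  let M : Matrix (Fin n) (Fin n) ℝ := Matrix.of fun i j => if j ≤ i then 1 else 0
  have hdet : M.det = 1 := by
    rw [Matrix.det_of_isLowerTriangular M fun i j (hij : i < j) => by simp [M, hij.not_ge]]
    simp [M]
  have hM : (Matrix.toLin' M : (Fin n → ℝ) → Fin n → ℝ) = partialSums := by
    ext z i
    simp only [Matrix.toLin'_apply, Matrix.mulVec, dotProduct, M, Matrix.of_apply, ite_mul,
      one_mul, zero_mul, partialSums, ← Finset.sum_filter]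
    congr 1
    ext j
    simp
  have h := Real.map_matrix_volume_pi_eq_smul_volume_pi (M := M) (by simp [hdet])
  rw [hM, hdet] at h
  refine ⟨?_, by simpa using h⟩
  exact measurable_pi_lambda _ fun i =>
    Finset.measurable_sum _ fun j _ => measurable_pi_apply j

lemma partialSums_zero {n : ℕ} (z : Fin (n + 1) → ℝ) : partialSums z 0 = z 0 := by
  have : Finset.Iic (0 : Fin (n + 1)) = {0} := by ext; simp
  simp [partialSums, this]

lemma partialSums_succ {n : ℕ} (z : Fin (n + 1) → ℝ) (i : Fin n) :
    partialSums z i.succ = partialSums z i.castSucc + z i.succ := by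
  have : Finset.Iic i.succ = insert i.succ (Finset.Iic i.castSucc) := by
    ext j
    simp only [Finset.mem_Iic, Finset.mem_insert, Fin.le_def, Fin.ext_iff, Fin.val_succ,
      Fin.val_castSucc]
    omega
  rw [partialSums, this, Finset.sum_insert (by simp [Fin.le_def]), add_comm]
  rfl

lemma partialSums_last {n : ℕ} (z : Fin (n + 1) → ℝ) :
    partialSums z (Fin.last n) = ∑ i, z i := by
  have : Finset.Iic (Fin.last n) = Finset.univ := by ext; simp [Fin.le_last]
  rw [partialSums, this]

lemma partialSums_preimage (n : ℕ) :
    partialSums ⁻¹' ({x : Fin n → ℝ | StrictMono x} ∩ posOrthant n) = posOrthant n := by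
  cases n with
  | zero =>
    ext x
    simp [posOrthant, StrictMono]
  | succ n =>
    ext z
    simp only [Set.mem_preimage, Set.mem_inter_iff, Set.mem_ofPred_eq, mem_posOrthant,
      Fin.strictMono_iff_lt_succ, partialSums_succ]
    constructor
    · rintro ⟨h1, h2⟩ i
      refine Fin.cases ?_ (fun i => ?_) i
      · simpa [partialSums_zero] using h2 0
      · linarith [h1 i]
    · intro h
      exact ⟨fun i => by linarith [h i.succ],
        fun i => Finset.sum_pos (fun j _ => h j) ⟨i, by simp⟩⟩

lemma orderStat_mem_posOrthant {n : ℕ} {x : Fin n → ℝ} :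
    orderStat x ∈ posOrthant n ↔ x ∈ posOrthant n := by
  simp only [mem_posOrthant, orderStat, Function.comp_apply]
  exact (Tuple.sort x).forall_congr_left.trans (by simp)

/-- Order statistics of a positive sample are the partial sums of their gaps. -/
lemma setLIntegral_orderStat {n : ℕ} {h : (Fin n → ℝ) → ℝ≥0∞} (hh : Measurable h) :
    ∫⁻ x in posOrthant n, h (orderStat x)
      = n.factorial * ∫⁻ z in posOrthant n, h (partialSums z) := by
  have hpos := measurableSet_posOrthant n
  rw [← lintegral_indicator hpos, lintegral_eq_factorial_mul, setLIntegral_indicator hpos]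
  · congr 1
    have hT := (measurePreserving_partialSums n).setLIntegral_comp_preimage
      ((measurableSet_strictMono n).inter hpos) hh
    rw [partialSums_preimage, Set.inter_comm] at hT
    rw [hT]
    refine setLIntegral_congr_fun (hpos.inter (measurableSet_strictMono n)) fun x hx => ?_
    have hx' : StrictMono x := hx.2
    simp only [orderStat_of_monotone hx'.monotone]
  · intro x σ
    have : x ∘ σ ∈ posOrthant n ↔ x ∈ posOrthant n := by
      rw [← orderStat_mem_posOrthant, orderStat_comp, orderStat_mem_posOrthant]
    by_cases hx : x ∈ posOrthant n <;> simp [this, hx, orderStat_comp]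

/-! ### The exponential sample -/

lemma sum_partialSums {n : ℕ} (z : Fin n → ℝ) :
    ∑ i, partialSums z i = ∑ j : Fin n, ((n : ℝ) - (j : ℕ)) * z j := by
  have h : ∀ i, partialSums z i = ∑ j, if j ≤ i then z j else 0 := fun i => by
    rw [partialSums, ← Finset.sum_filter]
    congr 1
    ext j
    simp
  simp_rw [h]
  rw [Finset.sum_comm]
  refine Finset.sum_congr rfl fun j _ => ?_
  rw [← Finset.sum_filter, Finset.sum_const, nsmul_eq_mul]
  have : Finset.univ.filter (fun i => j ≤ i) = Finset.Ici j := by ext; simp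
  rw [this, Fin.card_Ici, Nat.cast_sub j.2.le]

lemma prod_rates (n : ℕ) : ∏ i : Fin n, ((n : ℝ) - (i : ℕ)) = n.factorial := by
  rw [Fin.prod_univ_eq_prod_range (fun i : ℕ => (n : ℝ) - i), ← Finset.prod_range_reflect,
    ← Finset.prod_range_add_one_eq_factorial]
  push_cast
  refine Finset.prod_congr rfl fun i hi => ?_
  have : i + 1 ≤ n := Finset.mem_range.1 hi
  rw [show n - 1 - i = n - (i + 1) by omega, Nat.cast_sub this]
  push_cast
  ring

lemma rate_pos {n : ℕ} (i : Fin n) : 0 < (n : ℝ) - (i : ℕ) :=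
  sub_pos.2 (Nat.cast_lt.2 i.2)

/-- Rényi's representation: the gaps between the order statistics of an exponential sample are
independent and exponential, with rates `n, n - 1, …, 1`. -/
lemma pi_expMeasure_orderStat {n : ℕ} {B : Set (Fin n → ℝ)} (hB : MeasurableSet B) :
    Measure.pi (fun _ : Fin n => expMeasure 1) (orderStat ⁻¹' B)
      = Measure.pi (fun i : Fin n => expMeasure ((n : ℝ) - (i : ℕ))) (partialSums ⁻¹' B) := by
  have hT := (measurePreserving_partialSums n).measurable
  set h : (Fin n → ℝ) → ℝ≥0∞ := B.indicator fun y => ENNReal.ofReal (Real.exp (-∑ i, y i)) with hh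
  have hhm : Measurable h := Measurable.indicator (by fun_prop) hB
  rw [pi_expMeasure fun _ => one_pos, pi_expMeasure rate_pos,
    withDensity_apply _ (measurable_orderStat hB), withDensity_apply _ (hT hB),
    ← lintegral_indicator (measurable_orderStat hB), ← lintegral_indicator (hT hB)]
  calc _ = ∫⁻ x in posOrthant n, h (orderStat x) := by
        refine lintegral_congr fun x => ?_
        have hs : ∑ i, orderStat x i = ∑ i, x i := Equiv.sum_comp (Tuple.sort x) x
        by_cases hx : orderStat x ∈ B <;> simp [hh, hx, hs]
    _ = n.factorial * ∫⁻ z in posOrthant n, h (partialSums z) := setLIntegral_orderStat hhm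
    _ = _ := by
        rw [← lintegral_const_mul (n.factorial : ℝ≥0∞) (f := fun z => h (partialSums z))
          (hhm.comp hT)]
        refine lintegral_congr fun z => ?_
        by_cases hz : partialSums z ∈ B
        · simp only [hh, hz, Set.indicator_of_mem, Set.mem_preimage, prod_rates, sum_partialSums]
          rw [ENNReal.ofReal_mul (by positivity), ENNReal.ofReal_natCast]
        · simp [hh, hz]

instance isProbabilityMeasure_expMeasure_rate {n : ℕ} (i : Fin n) :
    IsProbabilityMeasure (expMeasure ((n : ℝ) - (i : ℕ))) :=
  isProbabilityMeasure_expMeasure (rate_pos i)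

instance isProbabilityMeasure_expMeasure_one : IsProbabilityMeasure (expMeasure 1) :=
  isProbabilityMeasure_expMeasure one_pos

/-- A sum of independent exponentials with rates `m + 1, …, 1` is distributed as the maximum of
`m + 1` standard exponentials. -/
lemma pi_expMeasure_sum_le {m : ℕ} {c : ℝ} (hc : 0 ≤ c) :
    Measure.pi (fun i : Fin (m + 1) => expMeasure (((m + 1 : ℕ) : ℝ) - (i : ℕ)))
      {w | ∑ i, w i ≤ c} = ENNReal.ofReal ((1 - Real.exp (-c)) ^ (m + 1)) := by
  have hB : MeasurableSet {y : Fin (m + 1) → ℝ | y (Fin.last m) ≤ c} :=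
    measurableSet_le (measurable_pi_apply _) measurable_const
  have h := pi_expMeasure_orderStat hB
  have h1 : partialSums ⁻¹' {y : Fin (m + 1) → ℝ | y (Fin.last m) ≤ c} = {w | ∑ i, w i ≤ c} := by
    ext w
    simp [partialSums_last]
  have h2 : orderStat ⁻¹' {y : Fin (m + 1) → ℝ | y (Fin.last m) ≤ c}
      = Set.univ.pi fun _ => Set.Iic c := by
    ext x
    simp only [Set.mem_preimage, Set.mem_ofPred_eq, Set.mem_univ_pi, Set.mem_Iic]
    constructor
    · intro h i
      have := monotone_orderStat x (Fin.le_last ((Tuple.sort x).symm i))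
      simp only [orderStat, Function.comp_apply, Equiv.apply_symm_apply] at this h
      linarith
    · exact fun h => h _
  have hcdf : expMeasure 1 (Set.Iic c) = ENNReal.ofReal (1 - Real.exp (-c)) := by
    have := cdf_expMeasure_eq one_pos c
    rw [if_pos hc, one_mul, cdf_eq_real] at this
    rw [← this, ofReal_measureReal]
  rw [h1, h2, Measure.pi_pi, Finset.prod_const, hcdf, Finset.card_univ, Fintype.card_fin] at h
  rw [← h, ENNReal.ofReal_pow]
  simpa using hc

lemma one_sub_one_sub_pow (q : ℝ) (d : ℕ) : 1 - (1 - q) ^ (d + 1)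
    = ∑ j ∈ Finset.range (d + 1), (-1) ^ j * ((d + 1).choose (j + 1) : ℝ) * q ^ (j + 1) := by
  rw [sub_eq_add_neg 1 q, add_comm 1, add_pow, Finset.sum_range_succ', sub_eq_iff_eq_add]
  simp only [one_pow, mul_one, pow_zero, Nat.choose_zero_right, Nat.cast_one]
  rw [add_comm _ (1 : ℝ), add_left_comm, left_eq_add, ← Finset.sum_add_distrib]
  refine Finset.sum_eq_zero fun j _ => ?_
  rw [neg_pow q]
  ring

lemma pi_expMeasure_lt_sum {d : ℕ} {c : ℝ} (hc : 0 ≤ c) :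
    Measure.pi (fun i : Fin (d + 1) => expMeasure (((d + 1 : ℕ) : ℝ) - (i : ℕ)))
      {w | c < ∑ i, w i} = ENNReal.ofReal (∑ j ∈ Finset.range (d + 1),
        (-1) ^ j * ((d + 1).choose (j + 1) : ℝ) * Real.exp (-c) ^ (j + 1)) := by
  have hm : MeasurableSet {w : Fin (d + 1) → ℝ | ∑ i, w i ≤ c} :=
    measurableSet_le (by fun_prop) measurable_const
  have : {w : Fin (d + 1) → ℝ | c < ∑ i, w i} = {w | ∑ i, w i ≤ c}ᶜ := by
    ext w
    simp
  rw [this, prob_compl_eq_one_sub hm, pi_expMeasure_sum_le hc, ← one_sub_one_sub_pow,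
    ENNReal.ofReal_sub _ (pow_nonneg (by simpa using hc) _), ENNReal.ofReal_one]

lemma lintegral_exp_expMeasure {r c : ℝ} (hr : 0 < r) (hc : 0 ≤ c) :
    ∫⁻ x, ENNReal.ofReal (Real.exp (-(c * x))) ∂expMeasure r = ENNReal.ofReal (r / (r + c)) := by
  have hrc : 0 < r + c := by positivity
  have := isProbabilityMeasure_expMeasure hrc
  have h1 : expMeasure (r + c) Set.univ = 1 := measure_univ
  rw [expMeasure_eq, withDensity_apply _ MeasurableSet.univ, setLIntegral_univ] at h1
  rw [expMeasure_eq, lintegral_withDensity_eq_lintegral_mul _ (by fun_prop) (by fun_prop),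
    ← mul_one (ENNReal.ofReal (r / (r + c))), ← h1, ← lintegral_const_mul _ (by fun_prop)]
  refine lintegral_congr fun x => ?_
  rw [Pi.mul_apply, ← ENNReal.ofReal_mul (by positivity), ← ENNReal.ofReal_mul (by positivity)]
  congr 1
  rw [mul_assoc, ← Real.exp_add, ← mul_assoc]
  congr 1
  · field_simp
  · congr 1
    ring

lemma integral_exp_expMeasure {r c : ℝ} (hr : 0 < r) (hc : 0 ≤ c) :
    ∫ x, Real.exp (-(c * x)) ∂expMeasure r = r / (r + c) := by
  rw [integral_eq_lintegral_of_nonneg_ae (.of_forall fun _ => (Real.exp_pos _).le) (by fun_prop),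
    lintegral_exp_expMeasure hr hc, ENNReal.toReal_ofReal (by positivity)]

lemma integrable_exp_expMeasure {r c : ℝ} (hr : 0 < r) (hc : 0 ≤ c) :
    Integrable (fun x => Real.exp (-(c * x))) (expMeasure r) := by
  refine ⟨by fun_prop, ?_⟩
  rw [hasFiniteIntegral_iff_ofReal (.of_forall fun _ => (Real.exp_pos _).le),
    lintegral_exp_expMeasure hr hc]
  exact ENNReal.ofReal_lt_top

lemma measurePreserving_append {a b : ℕ} (μ : Fin (a + b) → Measure ℝ) [∀ i, SigmaFinite (μ i)] :
    MeasurePreserving (fun p : (Fin a → ℝ) × (Fin b → ℝ) => Fin.append p.1 p.2)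
      ((Measure.pi fun i => μ (Fin.castAdd b i)).prod (Measure.pi fun i => μ (Fin.natAdd a i)))
      (Measure.pi μ) := by
  have hm : Measurable fun p : (Fin a → ℝ) × (Fin b → ℝ) => Fin.append p.1 p.2 := by
    refine measurable_pi_lambda _ fun i => ?_
    refine Fin.addCases (fun i => ?_) (fun i => ?_) i
    · simp only [Fin.append_left]
      fun_prop
    · simp only [Fin.append_right]
      fun_prop
  refine ⟨hm, (Measure.pi_eq fun s hs => ?_).symm⟩
  rw [Measure.map_apply hm (MeasurableSet.univ_pi hs), Fin.prod_univ_add, ← Measure.pi_pi,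
    ← Measure.pi_pi, ← Measure.prod_prod]
  congr 1
  ext p
  simp only [Set.mem_preimage, Set.mem_univ_pi, Set.mem_prod]
  constructor
  · exact fun h => ⟨fun i => by simpa using h (Fin.castAdd b i),
      fun i => by simpa using h (Fin.natAdd a i)⟩
  · rintro ⟨h1, h2⟩ i
    refine Fin.addCases (fun i => ?_) (fun i => ?_) i
    · simpa using h1 i
    · simpa using h2 i

lemma partialSums_append_left {a b : ℕ} (u : Fin a → ℝ) (w : Fin b → ℝ) (i : Fin a) :
    partialSums (Fin.append u w) (Fin.castAdd b i) = partialSums u i := by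
  have : Finset.Iic (Fin.castAdd b i) = (Finset.Iic i).map (Fin.castAddEmb b) := by
    ext j
    refine Fin.addCases (fun j => ?_) (fun j => ?_) j
    · simp [← Fin.val_fin_le]
    · simp [Fin.le_def]
  rw [partialSums, this, Finset.sum_map]
  simp [partialSums]

/-- The set where the largest of `n` ordered values exceeds the sum of the `k - 1` smallest. -/
def largestExceeds (k n : ℕ) (hk : 3 ≤ k) (hkn : k ≤ n) : Set (Fin n → ℝ) :=
  {y | ∑ i : Fin (k - 1), y (Fin.castLE (pred_le_of_le hkn) i)
    < y ⟨n - 1, pred_lt_of_three_le hk hkn⟩}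

lemma measurableSet_largestExceeds {k n : ℕ} (hk : 3 ≤ k) (hkn : k ≤ n) :
    MeasurableSet (largestExceeds k n hk hkn) :=
  measurableSet_lt (by fun_prop) (by fun_prop)

/-- In terms of the first `k - 1` gaps `u` and the remaining gaps `w`, the event compares a weighted
sum of the former with the sum of the latter. -/
lemma append_mem_largestExceeds_iff {t d : ℕ} (u : Fin (t + 2) → ℝ) (w : Fin (d + 1) → ℝ) :
    partialSums (Fin.append u w) ∈
        largestExceeds (t + 3) (t + 2 + (d + 1)) (by omega) (by omega) ↔
      ∑ i : Fin (t + 2), ((t : ℝ) + 1 - (i : ℕ)) * u i < ∑ i, w i := by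
  have h1 : ∑ i : Fin (t + 2), partialSums (Fin.append u w) (Fin.castAdd (d + 1) i)
      = ∑ i : Fin (t + 2), ((t : ℝ) + 1 - (i : ℕ)) * u i + ∑ i, u i := by
    simp_rw [partialSums_append_left]
    rw [sum_partialSums, ← Finset.sum_add_distrib]
    refine Finset.sum_congr rfl fun i _ => ?_
    push_cast
    ring
  have h2 : partialSums (n := t + 2 + (d + 1)) (Fin.append u w) (Fin.last (t + 2 + d))
      = ∑ i, u i + ∑ i, w i := by
    refine (partialSums_last (n := t + 2 + d)
      (Fin.append u w : Fin (t + 2 + (d + 1)) → ℝ)).trans ?_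
    refine (Fin.sum_univ_add (a := t + 2) (b := d + 1) (Fin.append u w)).trans ?_
    simp
  change (∑ i : Fin (t + 2), partialSums (Fin.append u w) (Fin.castAdd (d + 1) i)
    < partialSums (n := t + 2 + (d + 1)) (Fin.append u w) (Fin.last (t + 2 + d))) ↔ _
  rw [h1, h2, add_comm, add_lt_add_iff_left]

/-- The product of Laplace transforms arising from one summand of the tail probability. -/
lemma integral_exp_gaps (t d j : ℕ) :
    ∫ u : Fin (t + 2) → ℝ, ∏ i : Fin (t + 2),
        Real.exp (-((((j : ℝ) + 1) * ((t : ℝ) + 1 - (i : ℕ))) * u i))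
      ∂Measure.pi (fun i : Fin (t + 2) => expMeasure (((t + 2 + (d + 1) : ℕ) : ℝ) - (i : ℕ)))
      = ∏ i : Fin (t + 1), (((t + 3 + d : ℕ) : ℝ) - (i : ℕ)) /
          ((((t + 3 + d : ℕ) : ℝ) - (i : ℕ)) + ((j : ℝ) + 1) * ((t : ℝ) + 1 - (i : ℕ))) := by
  have hpos : ∀ i : Fin (t + 2), 0 < ((t + 2 + (d + 1) : ℕ) : ℝ) - (i : ℕ) := fun i =>
    rate_pos (Fin.castAdd (d + 1) i)
  have : ∀ i : Fin (t + 2),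
      IsProbabilityMeasure (expMeasure (((t + 2 + (d + 1) : ℕ) : ℝ) - (i : ℕ))) := fun i =>
    isProbabilityMeasure_expMeasure (hpos i)
  have hco : ∀ i : Fin (t + 2), 0 ≤ ((j : ℝ) + 1) * ((t : ℝ) + 1 - (i : ℕ)) := fun i => by
    have : ((i : ℕ) : ℝ) ≤ t + 1 := by exact_mod_cast Nat.le_of_lt_succ i.2
    exact mul_nonneg (by positivity) (by linarith)
  rw [integral_fintype_prod_eq_prod (fun (i : Fin (t + 2)) (x : ℝ) =>
    Real.exp (-((((j : ℝ) + 1) * ((t : ℝ) + 1 - (i : ℕ))) * x))), Fin.prod_univ_castSucc]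
  simp only [integral_exp_expMeasure (hpos _) (hco _)]
  have hlast : ((t : ℝ) + 1 - ((Fin.last (t + 1) : Fin (t + 2)) : ℕ)) = 0 := by simp
  -- The last of these gaps has weight `0` and contributes the factor `1`.
  rw [hlast, mul_zero, add_zero, div_self (hpos _).ne', mul_one]
  refine Finset.prod_congr rfl fun i _ => ?_
  rw [show t + 2 + (d + 1) = t + 3 + d by ring]
  rfl

theorem pi_expMeasure_largestExceeds {k n : ℕ} (hk : 3 ≤ k) (hkn : k ≤ n) :
    (Measure.pi fun _ : Fin n => expMeasure 1).real
      (orderStat ⁻¹' largestExceeds k n hk hkn) = failFormula k n := by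
  obtain ⟨t, rfl⟩ := Nat.exists_eq_add_of_le' hk
  obtain ⟨d, rfl⟩ : ∃ d, n = t + 2 + (d + 1) := ⟨n - (t + 3), by omega⟩
  set ν := Measure.pi fun i : Fin (t + 2) => expMeasure (((t + 2 + (d + 1) : ℕ) : ℝ) - (i : ℕ))
    with hν
  have hpos : ∀ i : Fin (t + 2), 0 < ((t + 2 + (d + 1) : ℕ) : ℝ) - (i : ℕ) := fun i =>
    rate_pos (Fin.castAdd (d + 1) i)
  have hprob : ∀ i : Fin (t + 2),
      IsProbabilityMeasure (expMeasure (((t + 2 + (d + 1) : ℕ) : ℝ) - (i : ℕ))) := fun i =>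
    isProbabilityMeasure_expMeasure (hpos i)
  have hmeas := measurableSet_largestExceeds hk hkn
  have hT := (measurePreserving_partialSums (t + 2 + (d + 1))).measurable
  have happ := measurePreserving_append (a := t + 2) (b := d + 1)
    fun i => expMeasure (((t + 2 + (d + 1) : ℕ) : ℝ) - (i : ℕ))
  set g : (Fin (t + 2) → ℝ) → ℝ := fun u => ∑ j ∈ Finset.range (d + 1),
    (-1) ^ j * ((d + 1).choose (j + 1) : ℝ) * ∏ i : Fin (t + 2),
      Real.exp (-((((j : ℝ) + 1) * ((t : ℝ) + 1 - (i : ℕ))) * u i)) with hg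
  have hint : ∀ j : ℕ, Integrable (fun u : Fin (t + 2) → ℝ => ∏ i : Fin (t + 2),
      Real.exp (-((((j : ℝ) + 1) * ((t : ℝ) + 1 - (i : ℕ))) * u i))) ν := fun j => by
    refine Integrable.fintype_prod (f := fun (i : Fin (t + 2)) (x : ℝ) =>
      Real.exp (-((((j : ℝ) + 1) * ((t : ℝ) + 1 - (i : ℕ))) * x))) fun i => ?_
    have : ((i : ℕ) : ℝ) ≤ t + 1 := by exact_mod_cast Nat.le_of_lt_succ i.2
    exact integrable_exp_expMeasure (hpos i) (mul_nonneg (by positivity) (by linarith))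
  have hslice : ∀ᵐ u ∂ν, 0 ≤ g u ∧
      Measure.pi (fun i : Fin (d + 1) => expMeasure (((d + 1 : ℕ) : ℝ) - (i : ℕ)))
        {w | ∑ i : Fin (t + 2), ((t : ℝ) + 1 - (i : ℕ)) * u i < ∑ i, w i}
        = ENNReal.ofReal (g u) := by
    filter_upwards [pi_expMeasure_posOrthant hpos] with u hu
    have hL : 0 ≤ ∑ i : Fin (t + 2), ((t : ℝ) + 1 - (i : ℕ)) * u i :=
      Finset.sum_nonneg fun i _ => by
        have : ((i : ℕ) : ℝ) ≤ t + 1 := by exact_mod_cast Nat.le_of_lt_succ i.2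
        exact mul_nonneg (by linarith) (mem_posOrthant.1 hu i).le
    have hgu : g u = ∑ j ∈ Finset.range (d + 1), (-1) ^ j * ((d + 1).choose (j + 1) : ℝ) *
        Real.exp (-∑ i : Fin (t + 2), ((t : ℝ) + 1 - (i : ℕ)) * u i) ^ (j + 1) := by
      refine Finset.sum_congr rfl fun j _ => ?_
      rw [← Real.exp_nat_mul, ← Real.exp_sum, Finset.sum_neg_distrib, mul_neg, Finset.mul_sum]
      push_cast
      simp only [mul_assoc]
    refine ⟨?_, by rw [hgu, pi_expMeasure_lt_sum hL]⟩
    rw [hgu, ← one_sub_one_sub_pow, sub_nonneg]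
    exact pow_le_one₀ (by simpa using hL) (sub_le_self _ (Real.exp_pos _).le)
  -- The rates of the last `d + 1` gaps are again `d + 1, …, 1`.
  have hrates : (fun i : Fin (d + 1) => expMeasure
      (((t + 2 + (d + 1) : ℕ) : ℝ) - ((Fin.natAdd (t + 2) i : Fin _) : ℕ)))
      = fun i : Fin (d + 1) => expMeasure (((d + 1 : ℕ) : ℝ) - (i : ℕ)) := by
    funext i
    congr 1
    simp only [Fin.val_natAdd]
    push_cast
    ring
  have key : Measure.pi (fun _ : Fin (t + 2 + (d + 1)) => expMeasure 1)
      (orderStat ⁻¹' largestExceeds (t + 3) (t + 2 + (d + 1)) hk hkn)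
      = ∫⁻ u, ENNReal.ofReal (g u) ∂ν := by
    rw [pi_expMeasure_orderStat hmeas, ← happ.measure_preimage (hT hmeas).nullMeasurableSet,
      Measure.prod_apply (happ.measurable (hT hmeas)), hrates]
    refine lintegral_congr_ae ?_
    filter_upwards [hslice] with u hu
    rw [← hu.2]
    congr 1
    ext w
    exact append_mem_largestExceeds_iff u w
  rw [measureReal_def, key, ← integral_eq_lintegral_of_nonneg_ae (hslice.mono fun u hu => hu.1)
    (integrable_finsetSum _ fun j _ => (hint j).const_mul _).aestronglyMeasurable,
    integral_finsetSum _ fun j _ => (hint j).const_mul _,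
    show t + 2 + (d + 1) = t + 3 + d by ring, failFormula_eq_sum_prod]
  refine Finset.sum_congr rfl fun j _ => ?_
  rw [integral_const_mul, integral_exp_gaps]

/-- Equality of the largest value with the sum of the `k - 1` smallest has probability zero. -/
lemma pi_expMeasure_largestExceeds_ae {k n : ℕ} (hk : 3 ≤ k) (hkn : k ≤ n) :
    ∀ᵐ x ∂Measure.pi (fun _ : Fin n => expMeasure 1),
      ∑ i : Fin (k - 1), orderStat x (Fin.castLE (pred_le_of_le hkn) i)
        ≠ orderStat x ⟨n - 1, pred_lt_of_three_le hk hkn⟩ := by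
  have hB : MeasurableSet {y : Fin n → ℝ |
      ∑ i : Fin (k - 1), y (Fin.castLE (pred_le_of_le hkn) i)
        = y ⟨n - 1, pred_lt_of_three_le hk hkn⟩} :=
    measurableSet_eq_fun (by fun_prop) (by fun_prop)
  rw [ae_iff]
  simp only [not_not]
  refine (pi_expMeasure_orderStat hB).trans ?_
  rw [pi_expMeasure rate_pos]
  refine ((withDensity_absolutelyContinuous _ _).trans
    Measure.restrict_le_self.absolutelyContinuous) ?_
  let φ : (Fin n → ℝ) →ₗ[ℝ] ℝ :=
    { toFun := fun z => ∑ i : Fin (k - 1), partialSums z (Fin.castLE (pred_le_of_le hkn) i)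
        - partialSums z ⟨n - 1, pred_lt_of_three_le hk hkn⟩
      map_add' := fun x y => by
        simp only [partialSums, Pi.add_apply, Finset.sum_add_distrib]
        ring
      map_smul' := fun c x => by
        simp only [partialSums, Pi.smul_apply, smul_eq_mul, ← Finset.mul_sum, RingHom.id_apply]
        ring }
  have hφ : LinearMap.ker φ ≠ ⊤ := by
    intro h
    have h0 : φ (Pi.single ⟨n - 1, pred_lt_of_three_le hk hkn⟩ 1) = 0 :=
      LinearMap.mem_ker.1 (h ▸ Submodule.mem_top)
    have h1 : ∀ i : Fin (k - 1), partialSums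
        (Pi.single (⟨n - 1, pred_lt_of_three_le hk hkn⟩ : Fin n) (1 : ℝ))
        (Fin.castLE (pred_le_of_le hkn) i) = 0 := by
      intro i
      refine Finset.sum_eq_zero fun j hj => Pi.single_eq_of_ne (fun h => ?_) _
      have := Fin.le_def.1 (Finset.mem_Iic.1 hj)
      rw [h] at this
      simp at this
      omega
    have h2 : partialSums (Pi.single (⟨n - 1, pred_lt_of_three_le hk hkn⟩ : Fin n) (1 : ℝ))
        ⟨n - 1, pred_lt_of_three_le hk hkn⟩ = 1 := by
      simp [partialSums]
    simp only [φ, LinearMap.coe_mk, AddHom.coe_mk, h1, h2] at h0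
    norm_num at h0
  convert Measure.addHaar_submodule volume _ hφ using 2
  ext z
  simp [φ, sub_eq_zero]

/-! ### The broken stick -/

/-- The `m + 1` consecutive differences of `0, y₀, …, yₘ₋₁, 1`. -/
def gaps {m : ℕ} (y : Fin m → ℝ) : Fin (m + 1) → ℝ :=
  fun i => (Fin.snoc y 1 : Fin (m + 1) → ℝ) i - (Fin.cons 0 y : Fin (m + 1) → ℝ) i

lemma gaps_partialSums {m : ℕ} (z : Fin m → ℝ) :
    gaps (partialSums z) = (Fin.snoc z (1 - ∑ i, z i) : Fin (m + 1) → ℝ) := by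
  cases m with
  | zero =>
    ext i
    fin_cases i
    simp [gaps, Fin.snoc]
  | succ m =>
    ext i
    refine Fin.lastCases ?_ (fun i => ?_) i
    · rw [gaps, Fin.snoc_last, Fin.snoc_last, ← Fin.succ_last, Fin.cons_succ, partialSums_last]
    · rw [gaps, Fin.snoc_castSucc, Fin.snoc_castSucc]
      refine Fin.cases ?_ (fun i => ?_) i
      · rw [Fin.castSucc_zero, Fin.cons_zero, partialSums_zero, sub_zero]
      · rw [← Fin.succ_castSucc, Fin.cons_succ, partialSums_succ]
        ring

lemma measurable_snoc {m : ℕ} {α : Type*} [MeasurableSpace α] {f : α → Fin m → ℝ} {g : α → ℝ}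
    (hf : Measurable f) (hg : Measurable g) :
    Measurable fun a => (Fin.snoc (f a) (g a) : Fin (m + 1) → ℝ) := by
  refine measurable_pi_lambda _ fun i => ?_
  refine Fin.lastCases ?_ (fun i => ?_) i
  · simpa only [Fin.snoc_last] using hg
  · simp only [Fin.snoc_castSucc]
    fun_prop

lemma measurable_gaps {m : ℕ} : Measurable (gaps : (Fin m → ℝ) → Fin (m + 1) → ℝ) := by
  have h : Measurable fun y : Fin m → ℝ => (Fin.cons 0 y : Fin (m + 1) → ℝ) := by
    refine measurable_pi_lambda _ fun i => ?_
    refine Fin.cases ?_ (fun i => ?_) i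
    · simp
    · simp only [Fin.cons_succ]
      fun_prop
  exact (measurable_snoc measurable_id measurable_const).sub h

/-- The slice of `A` by the hyperplane of coordinate sum `s`, inside the positive orthant and
parametrized by all coordinates but the last. -/
def slice {m : ℕ} (A : Set (Fin (m + 1) → ℝ)) (s : ℝ) : Set (Fin m → ℝ) :=
  {z | z ∈ posOrthant m ∧ ∑ i, z i < s ∧ (Fin.snoc z (s - ∑ i, z i) : Fin (m + 1) → ℝ) ∈ A}

lemma measurableSet_slice {m : ℕ} {A : Set (Fin (m + 1) → ℝ)} (hA : MeasurableSet A) :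
    MeasurableSet {p : ℝ × (Fin m → ℝ) | p.2 ∈ slice A p.1} := by
  refine (measurable_snd (measurableSet_posOrthant m)).inter
    ((measurableSet_lt (by fun_prop) measurable_fst).inter ?_)
  exact (measurable_snoc measurable_snd (by fun_prop :
    Measurable fun p : ℝ × (Fin m → ℝ) => p.1 - ∑ i, p.2 i)) hA

lemma slice_eq_smul {m : ℕ} {A : Set (Fin (m + 1) → ℝ)}
    (hcone : ∀ c : ℝ, 0 < c → ∀ x, c • x ∈ A ↔ x ∈ A) {s : ℝ} (hs : 0 < s) :
    slice A s = s • slice A 1 := by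
  ext z
  rw [Set.mem_smul_set_iff_inv_smul_mem₀ hs.ne']
  have hsnoc : (Fin.snoc z (s - ∑ i, z i) : Fin (m + 1) → ℝ)
      = s • (Fin.snoc (s⁻¹ • z) (1 - s⁻¹ * ∑ i, z i) : Fin (m + 1) → ℝ) := by
    ext i
    refine Fin.lastCases ?_ (fun i => ?_) i
    · simp only [Fin.snoc_last, Pi.smul_apply, smul_eq_mul]
      field_simp
    · simp only [Fin.snoc_castSucc, Pi.smul_apply, smul_eq_mul]
      field_simp
  simp only [slice, Set.mem_ofPred_eq, ← Finset.mul_sum, hsnoc, hcone s hs, mem_posOrthant,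
    Pi.smul_apply, smul_eq_mul, mul_pos_iff_of_pos_left (inv_pos.2 hs), inv_mul_lt_one₀ hs]

lemma slice_of_nonpos {m : ℕ} (A : Set (Fin (m + 1) → ℝ)) {s : ℝ} (hs : s ≤ 0) :
    slice A s = ∅ := by
  refine Set.eq_empty_of_forall_notMem fun z hz => ?_
  have : 0 ≤ ∑ i, z i := Finset.sum_nonneg fun i _ => (mem_posOrthant.1 hz.1 i).le
  linarith [hz.2.1]

lemma snoc_mem_posOrthant_iff {m : ℕ} {z : Fin m → ℝ} {t : ℝ} :
    (Fin.snoc z t : Fin (m + 1) → ℝ) ∈ posOrthant (m + 1) ↔ z ∈ posOrthant m ∧ 0 < t := by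
  simp only [mem_posOrthant, Fin.forall_fin_succ', Fin.snoc_castSucc, Fin.snoc_last]

lemma lintegral_exp_mul_pow (m : ℕ) :
    ∫⁻ s in Set.Ioi (0 : ℝ), ENNReal.ofReal (Real.exp (-s)) * ENNReal.ofReal (s ^ m)
      = m.factorial := by
  have hG : ∀ s : ℝ, Real.exp (-s) * s ^ (((m : ℝ) + 1) - 1) = Real.exp (-s) * s ^ m := fun s => by
    rw [add_sub_cancel_right, Real.rpow_natCast]
  have hint := Real.GammaIntegral_convergent (s := (m : ℝ) + 1) (by positivity)
  have hval := Real.Gamma_eq_integral (s := (m : ℝ) + 1) (by positivity)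
  simp only [hG, Real.Gamma_nat_eq_factorial] at hint hval
  rw [← ENNReal.ofReal_natCast, hval, ofReal_integral_eq_lintegral_ofReal hint]
  · exact lintegral_congr fun s => (ENNReal.ofReal_mul (Real.exp_pos _).le).symm
  · filter_upwards [ae_restrict_mem measurableSet_Ioi] with s hs
    have : (0 : ℝ) < s := hs
    positivity

/-- For a cone, the exponential sample sees only the slice at coordinate sum `1`: the total is
independent of the proportions. -/
lemma pi_expMeasure_cone {m : ℕ} {A : Set (Fin (m + 1) → ℝ)} (hA : MeasurableSet A)
    (hcone : ∀ c : ℝ, 0 < c → ∀ x, c • x ∈ A ↔ x ∈ A) :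
    Measure.pi (fun _ : Fin (m + 1) => expMeasure 1) A = m.factorial * volume (slice A 1) := by
  set G : (Fin (m + 1) → ℝ) → ℝ≥0∞ := (A ∩ posOrthant (m + 1)).indicator fun x =>
    ENNReal.ofReal (Real.exp (-∑ i, x i)) with hG
  have hGm : Measurable G :=
    Measurable.indicator (by fun_prop) (hA.inter (measurableSet_posOrthant _))
  have hsm := measurableSet_slice hA
  have hGs : ∀ (s : ℝ) (z : Fin m → ℝ), G (Fin.snoc z (s - ∑ i, z i))
      = (slice A s).indicator (fun _ => ENNReal.ofReal (Real.exp (-s))) z := by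
    intro s z
    have hsum : ∑ i, (Fin.snoc z (s - ∑ i, z i) : Fin (m + 1) → ℝ) i = s := by
      simp [Fin.sum_univ_castSucc]
    have hmem : (Fin.snoc z (s - ∑ i, z i) : Fin (m + 1) → ℝ) ∈ A ∩ posOrthant (m + 1)
        ↔ z ∈ slice A s := by
      rw [Set.mem_inter_iff, snoc_mem_posOrthant_iff, sub_pos]
      exact ⟨fun h => ⟨h.2.1, h.2.2, h.1⟩, fun h => ⟨h.2.2, h.1, h.2.1⟩⟩
    by_cases hz : z ∈ slice A s
    · rw [hG, Set.indicator_of_mem (hmem.2 hz), Set.indicator_of_mem hz, hsum]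
    · rw [hG, Set.indicator_of_notMem (mt hmem.1 hz), Set.indicator_of_notMem hz]
  calc _ = ∫⁻ x, G x := by
        rw [pi_expMeasure fun _ => one_pos, withDensity_apply _ hA, Measure.restrict_restrict hA,
          ← lintegral_indicator (hA.inter (measurableSet_posOrthant _))]
        simp [hG]
    _ = ∫⁻ p : ℝ × (Fin m → ℝ), G (Fin.snoc p.2 p.1) := by
        have e := (volume_preserving_piFinSuccAbove (fun _ : Fin (m + 1) => ℝ) (Fin.last m)).symm
        rw [← e.lintegral_comp_emb (MeasurableEquiv.measurableEmbedding _)]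
        refine lintegral_congr fun p => ?_
        congr 1
        exact Fin.insertNth_last' _ _
    _ = ∫⁻ z : Fin m → ℝ, ∫⁻ t, G (Fin.snoc z t) :=
        lintegral_prod_symm _
          (hGm.comp (measurable_snoc measurable_snd measurable_fst)).aemeasurable
    _ = ∫⁻ z : Fin m → ℝ, ∫⁻ s, G (Fin.snoc z (s - ∑ i, z i)) :=
        lintegral_congr fun z =>
          (lintegral_sub_right_eq_self (fun t => G (Fin.snoc z t)) (∑ i, z i)).symm
    _ = ∫⁻ s, ∫⁻ z : Fin m → ℝ, G (Fin.snoc z (s - ∑ i, z i)) := by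
        refine lintegral_lintegral_swap (Measurable.aemeasurable ?_)
        exact hGm.comp (measurable_snoc measurable_fst (by fun_prop :
          Measurable fun p : (Fin m → ℝ) × ℝ => p.2 - ∑ i, p.1 i))
    _ = ∫⁻ s, ENNReal.ofReal (Real.exp (-s)) * volume (slice A s) := by
        refine lintegral_congr fun s => ?_
        simp_rw [hGs]
        exact lintegral_indicator_const (measurable_prodMk_left hsm) _
    _ = ∫⁻ s in Set.Ioi 0, ENNReal.ofReal (Real.exp (-s)) * volume (slice A s) := by
        rw [← lintegral_indicator measurableSet_Ioi]
        refine lintegral_congr fun s => ?_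
        by_cases hs : 0 < s
        · rw [Set.indicator_of_mem (Set.mem_Ioi.2 hs)]
        · rw [Set.indicator_of_notMem (by simpa using hs), slice_of_nonpos A (not_lt.1 hs),
            measure_empty, mul_zero]
    _ = ∫⁻ s in Set.Ioi 0, (ENNReal.ofReal (Real.exp (-s)) * ENNReal.ofReal (s ^ m))
          * volume (slice A 1) := by
        refine setLIntegral_congr_fun measurableSet_Ioi fun s hs => ?_
        have hs' : (0 : ℝ) < s := hs
        rw [slice_eq_smul hcone hs', Measure.addHaar_smul_of_nonneg _ hs'.le,
          Module.finrank_fin_fun, mul_assoc]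
    _ = _ := by rw [lintegral_mul_const _ (by fun_prop), lintegral_exp_mul_pow]

/-- The lengths of the pieces of the stick and an exponential sample give every cone the same
probability. -/
lemma pi_uniform_pieces {m : ℕ} {A : Set (Fin (m + 1) → ℝ)} (hA : MeasurableSet A)
    (hcone : ∀ c : ℝ, 0 < c → ∀ x, c • x ∈ A ↔ x ∈ A) :
    Measure.pi (fun _ : Fin m => volume.restrict (Set.Icc (0 : ℝ) 1)) {u | pieces u ∈ A}
      = Measure.pi (fun _ : Fin (m + 1) => expMeasure 1) A := by
  rw [pi_expMeasure_cone hA hcone]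
  set B : Set (Fin m → ℝ) := {y | (∀ i, y i < 1) ∧ gaps y ∈ A} with hB
  have hlt1 : MeasurableSet {y : Fin m → ℝ | ∀ i, y i < 1} := by
    simp only [Set.ofPred_forall]
    exact MeasurableSet.iInter fun i => measurableSet_lt (measurable_pi_apply i) measurable_const
  have hBm : MeasurableSet B := hlt1.inter (measurable_gaps hA)
  have hm : MeasurableSet {u : Fin m → ℝ | pieces u ∈ A} :=
    (measurable_gaps.comp measurable_orderStat) hA
  have hlt : ∀ x : Fin m → ℝ, (∀ i, orderStat x i < 1) ↔ ∀ i, x i < 1 := fun x =>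
    (Tuple.sort x).forall_congr_left.trans (by simp [orderStat])
  have hT := (measurePreserving_partialSums m).measurable
  calc _ = volume ({u | pieces u ∈ A} ∩ Set.univ.pi fun _ => Set.Ioo (0 : ℝ) 1) := by
        simp_rw [← restrict_Ioo_eq_restrict_Icc]
        rw [← Measure.restrict_pi_pi, ← volume_pi, Measure.restrict_apply hm]
    _ = volume (orderStat ⁻¹' B ∩ posOrthant m) := by
        congr 1
        ext x
        simp only [Set.mem_inter_iff, Set.mem_ofPred_eq, Set.mem_univ_pi, Set.mem_Ioo, forall_and,
          Set.mem_preimage, mem_posOrthant, hB, hlt]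
        exact ⟨fun h => ⟨⟨h.2.2, h.1⟩, h.2.1⟩, fun h => ⟨h.1.2, h.2, h.1.1⟩⟩
    _ = ∫⁻ x in posOrthant m, B.indicator 1 (orderStat x) := by
        rw [← Measure.restrict_apply (measurable_orderStat hBm),
          ← lintegral_indicator_one (measurable_orderStat hBm)]
        rfl
    _ = m.factorial * ∫⁻ z in posOrthant m, B.indicator 1 (partialSums z) :=
        setLIntegral_orderStat (measurable_one.indicator hBm)
    _ = m.factorial * volume (partialSums ⁻¹' B ∩ posOrthant m) := by
        rw [← Measure.restrict_apply (hT hBm), ← lintegral_indicator_one (hT hBm)]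
        rfl
    _ = _ := by
        congr 2
        ext z
        simp only [Set.mem_inter_iff, Set.mem_preimage, hB, Set.mem_ofPred_eq, gaps_partialSums,
          slice]
        have : z ∈ posOrthant m → ((∀ i, partialSums z i < 1) ↔ ∑ i, z i < 1) := by
          intro hz
          rw [mem_posOrthant] at hz
          refine ⟨fun h => ?_, fun h i => lt_of_le_of_lt ?_ h⟩
          · cases m with
            | zero => simp
            | succ m => exact partialSums_last z ▸ h (Fin.last m)
          · exact Finset.sum_le_sum_of_subset_of_nonneg (Finset.subset_univ _)
              fun j _ _ => (hz j).le
        constructor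
        · rintro ⟨⟨h1, h2⟩, h3⟩
          exact ⟨h3, (this h3).1 h1, h2⟩
        · rintro ⟨h3, h1, h2⟩
          exact ⟨⟨(this h3).2 h1, h2⟩, h3⟩

/-! ### From the models to the random variables -/

lemma orderStat_smul {n : ℕ} {c : ℝ} (hc : 0 < c) (x : Fin n → ℝ) :
    orderStat (c • x) = c • orderStat x := by
  have hmono : Monotone ((c • x) ∘ Tuple.sort x) := fun i j hij =>
    mul_le_mul_of_nonneg_left (monotone_orderStat x hij) hc.le
  exact (Tuple.comp_sort_eq_comp_iff_monotone.2 hmono).symm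

lemma ae_pieces_mem_posOrthant (m : ℕ) :
    ∀ᵐ u ∂Measure.pi (fun _ : Fin m => volume.restrict (Set.Icc (0 : ℝ) 1)),
      pieces u ∈ posOrthant (m + 1) := by
  refine (pi_uniform_pieces (A := (posOrthant (m + 1))ᶜ)
    (measurableSet_posOrthant _).compl fun c hc x => ?_).trans
    (pi_expMeasure_posOrthant fun _ => one_pos)
  simp only [Set.mem_compl_iff, mem_posOrthant, Pi.smul_apply, smul_eq_mul,
    mul_pos_iff_of_pos_left hc]

lemma map_uniform_sample {Ω : Type*} [MeasurableSpace Ω] {P : Measure Ω} {m : ℕ}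
    {U : Fin m → Ω → ℝ} (hU_indep : iIndepFun U P)
    (hU_unif : ∀ i, pdf.IsUniform (U i) (Set.Icc (0 : ℝ) 1) P volume) :
    AEMeasurable (fun ω i => U i ω) P ∧ P.map (fun ω i => U i ω)
      = Measure.pi fun _ : Fin m => volume.restrict (Set.Icc (0 : ℝ) 1) := by
  have hae : ∀ i, AEMeasurable (U i) P := fun i =>
    (hU_unif i).aemeasurable (by simp) (by simp)
  have hmap : ∀ i, P.map (U i) = volume.restrict (Set.Icc (0 : ℝ) 1) := fun i => by
    rw [hU_unif i, ProbabilityTheory.cond]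
    simp
  refine ⟨aemeasurable_pi_lambda _ hae, ?_⟩
  rw [iIndepFun.map_fun_eq_pi_map hae hU_indep]
  simp_rw [hmap]

/-- The event need not be measurable, since the breaking points are measurable only up to null
sets; null-measurability is what allows passing to the complementary event. -/
theorem prob_exists_not_formsPolygon {Ω : Type*} [MeasurableSpace Ω] {P : Measure Ω}
    [IsProbabilityMeasure P] {k m : ℕ} (hk : 3 ≤ k) (hkm : k ≤ m + 1)
    {U : Fin m → Ω → ℝ} (hU_indep : iIndepFun U P)
    (hU_unif : ∀ i, pdf.IsUniform (U i) (Set.Icc (0 : ℝ) 1) P volume) :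
    NullMeasurableSet {ω | ∃ s : Finset (Fin (m + 1)), s.card = k ∧
        ¬ FormsPolygon k (pieces (fun i => U i ω)) s} P ∧
      P.real {ω | ∃ s : Finset (Fin (m + 1)), s.card = k ∧
        ¬ FormsPolygon k (pieces (fun i => U i ω)) s} = failFormula k (m + 1) := by
  obtain ⟨hV, hmap⟩ := map_uniform_sample hU_indep hU_unif
  set A : Set (Fin (m + 1) → ℝ) := {x | ∑ i : Fin (k - 1),
    orderStat x (Fin.castLE (pred_le_of_le hkm) i)
      ≤ orderStat x ⟨m + 1 - 1, pred_lt_of_three_le hk hkm⟩} with hA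
  have hAm : MeasurableSet A := by
    have : MeasurableSet {y : Fin (m + 1) → ℝ |
        ∑ i : Fin (k - 1), y (Fin.castLE (pred_le_of_le hkm) i) ≤
          y ⟨m + 1 - 1, pred_lt_of_three_le hk hkm⟩} :=
      measurableSet_le (by fun_prop) (by fun_prop)
    exact measurable_orderStat this
  have hcone : ∀ c : ℝ, 0 < c → ∀ x, c • x ∈ A ↔ x ∈ A := fun c hc x => by
    simp only [hA, Set.mem_ofPred_eq, orderStat_smul hc, Pi.smul_apply, smul_eq_mul,
      ← Finset.mul_sum, mul_le_mul_iff_right₀ hc]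
  have hS : MeasurableSet {u : Fin m → ℝ | pieces u ∈ A} :=
    (measurable_gaps.comp measurable_orderStat) hAm
  have hev : {ω | ∃ s : Finset (Fin (m + 1)), s.card = k ∧
      ¬ FormsPolygon k (pieces (fun i => U i ω)) s}
        =ᵐ[P] (fun ω i => U i ω) ⁻¹' {u | pieces u ∈ A} := by
    have hpos := ae_of_ae_map hV (hmap ▸ ae_pieces_mem_posOrthant m)
    filter_upwards [hpos] with ω hω
    exact propext (exists_not_formsPolygon_iff hk hkm (mem_posOrthant.1 hω))
  refine ⟨(hV.nullMeasurableSet_preimage hS).congr hev.symm, ?_⟩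
  rw [measureReal_congr hev, measureReal_def, ← Measure.map_apply_of_aemeasurable hV hS, hmap,
    pi_uniform_pieces hAm hcone, ← measureReal_def, ← pi_expMeasure_largestExceeds hk hkm]
  -- Failure is a weak inequality, `largestExceeds` a strict one.
  refine measureReal_congr ?_
  filter_upwards [pi_expMeasure_largestExceeds_ae hk hkm] with x hx
  exact propext hx.le_iff_lt

theorem prob_largestExceeds {Ω : Type*} [MeasurableSpace Ω] {P : Measure Ω}
    {k n : ℕ} (hk : 3 ≤ k) (hkn : k ≤ n) {X : Fin n → Ω → ℝ}
    (hX_indep : iIndepFun X P) (hX_exp : ∀ i, HasLaw (X i) (expMeasure 1) P) :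
    P.real {ω | orderStat (fun l => X l ω) ∈ largestExceeds k n hk hkn} = failFormula k n := by
  have hae : ∀ i, AEMeasurable (X i) P := fun i => (hX_exp i).aemeasurable
  have hmap := iIndepFun.map_fun_eq_pi_map hae hX_indep
  simp_rw [(hX_exp _).map_eq] at hmap
  rw [← pi_expMeasure_largestExceeds hk hkn, ← hmap, measureReal_def, measureReal_def,
    Measure.map_apply_of_aemeasurable (aemeasurable_pi_lambda _ hae)
      (measurable_orderStat (measurableSet_largestExceeds hk hkn))]
  rfl

end BrokenStick

theorem theorem2 {Ω Ω' : Type*} [MeasurableSpace Ω] [MeasurableSpace Ω']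
    (P : Measure Ω) [IsProbabilityMeasure P] (P' : Measure Ω') [IsProbabilityMeasure P']
    (k n : ℕ) (hk : 3 ≤ k) (hkn : k ≤ n)
    -- the `n - 1` breaking points: independent and uniform on `[0, 1]`
    (U : Fin (n - 1) → Ω → ℝ) (hU_indep : iIndepFun U P)
    (hU_unif : ∀ i, pdf.IsUniform (U i) (Set.Icc (0 : ℝ) 1) P volume)
    -- a random sample of size `n` from the exponential distribution with mean `1`
    (X : Fin n → Ω' → ℝ) (hX_indep : iIndepFun X P')
    (hX_exp : ∀ i, HasLaw (X i) (expMeasure 1) P') :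
    -- some choice of `k` pieces does not form a `k`-gon
    P.real {ω | ∃ s : Finset (Fin (n - 1 + 1)), s.card = k ∧
        ¬ BrokenStick.FormsPolygon k (BrokenStick.pieces (fun i => U i ω)) s}
      = BrokenStick.failFormula k n ∧
    -- `P(Yₙ > Y₁ + ⋯ + Yₖ₋₁)` for the order statistics of the exponential sample
    P'.real {ω | ∑ i : Fin (k - 1),
          BrokenStick.orderStat (fun l => X l ω) (Fin.castLE (by omega) i)
        < BrokenStick.orderStat (fun l => X l ω) ⟨n - 1, by omega⟩}
      = BrokenStick.failFormula k n ∧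
    -- every choice of `k` pieces forms a `k`-gon
    P.real {ω | ∀ s : Finset (Fin (n - 1 + 1)), s.card = k →
        BrokenStick.FormsPolygon k (BrokenStick.pieces (fun i => U i ω)) s}
      = BrokenStick.verreaultFormula k n ∧
    BrokenStick.failFormula k n = 1 - BrokenStick.verreaultFormula k n ∧
    (k = n → BrokenStick.failFormula k n = (n : ℝ) / 2 ^ (n - 1)) := by
  obtain ⟨m, rfl⟩ : ∃ m, n = m + 1 := ⟨n - 1, by omega⟩
  have hsum := BrokenStick.failFormula_add_verreaultFormula hk hkn
  obtain ⟨hnull, hfail⟩ := BrokenStick.prob_exists_not_formsPolygon hk hkn hU_indep hU_unif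
  refine ⟨hfail, BrokenStick.prob_largestExceeds hk hkn hX_indep hX_exp, ?_, by linarith, ?_⟩
  · have hcompl := probReal_compl_eq_one_sub₀ hnull
    rw [hfail] at hcompl
    rw [eq_sub_of_add_eq' hsum, ← hcompl]
    congr 1
    ext ω
    simp only [Set.mem_compl_iff, Set.mem_ofPred_eq, not_exists, not_and, not_not]
    rfl
  · rintro rfl
    exact BrokenStick.failFormula_self hk
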